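/- Let $\alpha\in[0,1)$ and $\rho\in(\alpha,1)$, and let $W\colon(0,\infty)^2\to\mathbb R$ be continuous, symmetric and homogeneous of degree zero with $0\le W(x,y)\le (x/y)^{\alpha}+(y/x)^{\alpha}$. For $\varepsilon\ge 0$ put $K_\varepsilon=2+\varepsilon W$. A function $f\in L^1_{\mathrm{loc}}((0,\infty))$ is a self-similar profile for $K_\varepsilon$ if $f\ge 0$ almost everywhere, $f\not\equiv 0$, $x f(x)\in L^1_{\mathrm{loc}}([0,\infty))$, $\int_1^\infty x^{\alpha}f(x)\,dx<\infty$, and $$x^2f(x)=(1-\rho)\int_0^x yf(y)\,dy+\int_0^x\int_{x-y}^\infty yK_\varepsilon(y,z)f(y)f(z)\,dz\,dy\qquad\text{for almost every }x>0 .$$ It is normalised if $\int_0^R yf(y)\,dy\sim\frac{\rho^2}{\Gamma(2-\rho)}R^{1-\rho}$ as $R\to\infty$. Let $\bar f$ be the normalised self-similar profile for the constant kernel $K_0=2$ (for which $\alpha=0$ may be taken in the definition), and write $(\mathcal T g)(q)=\int_0^\infty g(x)e^{-qx}\,dx$. Then $\bar f$ is integrable on $(0,\infty)$, and for each $\delta>0$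 there is $\varepsilon_0>0$ such that for all $\varepsilon\in(0,\varepsilon_0]$ every normalised self-similar profile $f$ for $K_\varepsilon$ is integrable on $(0,\infty)$ and satisfies $$\sup_{q>0}\bigl|(\mathcal T f)(q)-(\mathcal T\bar f)(q)\bigr|\le\delta .$$ -/

import Mathlib

namespace Smoluchowski

open MeasureTheory

/-- The standing assumptions on the perturbation `W` of the constant kernel, with exponent `α`:
`W` is continuous, symmetric and homogeneous of degree zero on `(0,∞)²`, and
`0 ≤ W(x,y) ≤ (x/y)^α + (y/x)^α` there. -/
structure IsPerturbation (α : ℝ) (W : ℝ → ℝ → ℝ) : Prop where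
  continuousOn : ContinuousOn (fun p : ℝ × ℝ => W p.1 p.2) (Set.Ioi 0 ×ˢ Set.Ioi 0)
  symm : ∀ x > 0, ∀ y > 0, W x y = W y x
  homogeneous : ∀ a > 0, ∀ x > 0, ∀ y > 0, W (a * x) (a * y) = W x y
  nonneg : ∀ x > 0, ∀ y > 0, 0 ≤ W x y
  le : ∀ x > 0, ∀ y > 0, W x y ≤ (x / y) ^ α + (y / x) ^ α

/-- `f` is a self-similar profile with parameter `ρ` for the (non-negative, homogeneity zero)
coagulation kernel `K`, whose growth exponent is `α`. Only the values of `f` on `(0,∞)` matter.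
All integrands in the equation are non-negative, and the integrals are taken in `[0,∞]`, so that
the equation includes the finiteness of its right-hand side. -/
structure IsProfile (α ρ : ℝ) (K : ℝ → ℝ → ℝ) (f : ℝ → ℝ) : Prop where
  locallyIntegrableOn : LocallyIntegrableOn f (Set.Ioi 0) volume
  nonneg : ∀ᵐ x ∂volume.restrict (Set.Ioi (0 : ℝ)), 0 ≤ f x
  ne_zero : ¬ ∀ᵐ x ∂volume.restrict (Set.Ioi (0 : ℝ)), f x = 0
  /-- `x² f(x) = (1-ρ) ∫_0^x y f(y) dy + ∫_0^x ∫_{x-y}^∞ y K(y,z) f(y) f(z) dz dy` -/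
  equation : ∀ᵐ x ∂volume.restrict (Set.Ioi (0 : ℝ)),
    ENNReal.ofReal (x ^ 2 * f x) =
      ENNReal.ofReal (1 - ρ) * (∫⁻ y in Set.Ioo 0 x, ENNReal.ofReal (y * f y)) +
      ∫⁻ y in Set.Ioo 0 x, ∫⁻ z in Set.Ioi (x - y), ENNReal.ofReal (y * K y z * f y * f z)
  /-- `x f(x)` is locally integrable on `[0,∞)` -/
  locallyIntegrableOn_mul : LocallyIntegrableOn (fun x => x * f x) (Set.Ici 0) volume
  /-- `∫_1^∞ x^α f(x) dx < ∞` -/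
  integrableOn_rpow_mul : IntegrableOn (fun x => x ^ α * f x) (Set.Ioi 1) volume

/-- A profile normalised by its tail:
`∫_0^R y f(y) dy ∼ ρ² / Γ(2-ρ) R^(1-ρ)` as `R → ∞`. -/
structure IsNormalisedProfile (α ρ : ℝ) (K : ℝ → ℝ → ℝ) (f : ℝ → ℝ) : Prop extends
    IsProfile α ρ K f where
  tail : Asymptotics.IsEquivalent Filter.atTop
    (fun R : ℝ => ∫ y in Set.Ioo 0 R, y * f y)
    (fun R : ℝ => ρ ^ 2 / Real.Gamma (2 - ρ) * R ^ (1 - ρ))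

/-- The Laplace transform `(T f)(q) = ∫_0^∞ f(x) e^{-qx} dx`. -/
noncomputable def laplace (f : ℝ → ℝ) (q : ℝ) : ℝ :=
  ∫ x in Set.Ioi 0, f x * Real.exp (-(q * x))

end Smoluchowski

/-! The profile equation becomes an ordinary differential equation in Laplace variables. Let `Q(q) =
∫ f(x)(1 - e^{-qx}) dx`. Integrating the equation against `φ_q` and symmetrising the double integral
in `y, z` gives `q Q' = ρ Q - Q² - E`, where `E ≥ 0` is half the double integral of `εW(y,z) f(y)
f(z) (1 - e^{-qy})(1 - e^{-qz})` (`laplace_equation`, `IsNormalisedProfile.riccati`). The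
normalisation becomes `Q(q) ∼ ρ q^ρ` at `0` by an Abelian theorem and l'Hôpital, and for `E = 0` the
only such solution is `Q̄ = ρ q^ρ / (1 + q^ρ)`.

Since `E ≥ 0`, comparison gives `Q ≤ Q̄` whatever the size of `ε` (`le_of_riccati`). This bounds the
mass by `ρ` and all moments of order in `(0, ρ)` uniformly (`exists_moment_bound`), and these
moments bound `E` by a multiple of `ε q^(ρ+η)`. A second comparison (`ge_of_riccati`) then yields `Q
≥ Q̄ - C ε q^(ρ+η)`.

This lower bound is useful only for bounded `q`. For large `q`, `Q` is monotone and `Q̄` has nearly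
reached its limit `ρ`, so closeness at one large `L` suffices. Finally `T f` is the mass minus `Q`,
and the mass lies between `Q(L)` and `ρ`. -/

namespace Smoluchowski

open MeasureTheory Set Filter Topology

/-! ### The integration weight -/

/-- `φ_q(x) = ∫_0^q s e^{-sx} ds`, the weight that turns the profile equation into a first-order
equation for the desingularised Laplace transform. -/
noncomputable def weight (q x : ℝ) : ℝ :=
  (1 - Real.exp (-(q * x)) - q * x * Real.exp (-(q * x))) / x ^ 2

lemma one_sub_exp_nonneg {q x : ℝ} (hq : 0 ≤ q) (hx : 0 ≤ x) :
    0 ≤ 1 - Real.exp (-(q * x)) := by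
  have : Real.exp (-(q * x)) ≤ 1 := Real.exp_le_one_iff.2 (by nlinarith [mul_nonneg hq hx])
  linarith

lemma weight_numerator_nonneg {q x : ℝ} :
    0 ≤ 1 - Real.exp (-(q * x)) - q * x * Real.exp (-(q * x)) := by
  have h1 := Real.add_one_le_exp (q * x)
  have h2 : Real.exp (q * x) * Real.exp (-(q * x)) = 1 := by rw [← Real.exp_add]; simp
  nlinarith [Real.exp_pos (-(q * x))]

lemma weight_nonneg (q x : ℝ) : 0 ≤ weight q x :=
  div_nonneg weight_numerator_nonneg (sq_nonneg x)

lemma hasDerivAt_weight_primitive (q : ℝ) {x : ℝ} (hx : 0 < x) :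
    HasDerivAt (fun x => -((1 - Real.exp (-(q * x))) / x)) (weight q x) x := by
  have h1 : HasDerivAt (fun x => 1 - Real.exp (-(q * x))) (q * Real.exp (-(q * x))) x := by
    have := (((hasDerivAt_id x).const_mul q).neg.exp).const_sub 1
    refine this.congr_deriv ?_
    simp only [id, Pi.neg_apply]; ring
  refine ((h1.div (hasDerivAt_id x) hx.ne').neg).congr_deriv ?_
  simp only [weight, id]
  ring

lemma tendsto_weight_primitive {q : ℝ} (hq : 0 < q) :
    Tendsto (fun x => -((1 - Real.exp (-(q * x))) / x)) atTop (𝓝 0) := by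
  have h0 : Tendsto (fun x : ℝ => -(1 / x)) atTop (𝓝 0) := by
    simpa using (tendsto_inv_atTop_zero (𝕜 := ℝ)).neg
  refine tendsto_of_tendsto_of_tendsto_of_le_of_le' h0 tendsto_const_nhds ?_ ?_
  · filter_upwards [eventually_gt_atTop 0] with x hx
    gcongr
    linarith [Real.exp_pos (-(q * x))]
  · filter_upwards [eventually_gt_atTop 0] with x hx
    exact neg_nonpos.2 (div_nonneg (one_sub_exp_nonneg hq.le hx.le) hx.le)

lemma measurable_weight (q : ℝ) : Measurable (weight q) := by
  unfold weight; fun_prop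

/-- The weight has the elementary primitive `-(1 - e^{-qx})/x`, which vanishes at infinity.
Multiplied by `y`, the tail integral is exactly the factor `1 - e^{-qy}` of the desingularised
transform. -/
lemma lintegral_weight_Ioi {q y : ℝ} (hq : 0 < q) (hy : 0 < y) :
    ∫⁻ x in Ioi y, ENNReal.ofReal (weight q x) =
      ENNReal.ofReal ((1 - Real.exp (-(q * y))) / y) := by
  have hd : ∀ x ∈ Ici y, HasDerivAt (fun x => -((1 - Real.exp (-(q * x))) / x)) (weight q x) x :=
    fun x hx => hasDerivAt_weight_primitive q (hy.trans_le hx)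
  have hint := integrableOn_Ioi_deriv_of_nonneg' hd (fun x _ => weight_nonneg q x)
    (tendsto_weight_primitive hq)
  rw [← ofReal_integral_eq_lintegral_ofReal hint (ae_of_all _ fun x => weight_nonneg q x),
    integral_Ioi_of_hasDerivAt_of_nonneg' hd (fun x _ => weight_nonneg q x)
      (tendsto_weight_primitive hq)]
  simp

lemma lintegral_weight_Ioo {q y z : ℝ} (hq : 0 < q) (hy : 0 < y) (hz : 0 < z) :
    ∫⁻ x in Ioo y (y + z), ENNReal.ofReal (weight q x) =
      ENNReal.ofReal ((1 - Real.exp (-(q * y))) / y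
        - (1 - Real.exp (-(q * (y + z)))) / (y + z)) := by
  have h := lintegral_weight_Ioi hq hy
  have h2 := lintegral_weight_Ioi hq (add_pos hy hz)
  have hu : Ioi y = Ioc y (y + z) ∪ Ioi (y + z) :=
    (Ioc_union_Ioi_eq_Ioi (by linarith)).symm
  rw [hu, lintegral_union measurableSet_Ioi (by
    rw [Set.disjoint_left]; intro a ha hb; exact absurd ha.2 (not_le.2 hb)), h2,
    setLIntegral_congr Ioo_ae_eq_Ioc.symm] at h
  rw [ENNReal.ofReal_sub _ (div_nonneg (one_sub_exp_nonneg hq.le (by linarith)) (by linarith)), ← h]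
  exact (ENNReal.add_sub_cancel_right ENNReal.ofReal_ne_top).symm

/-! ### The profile equation in Laplace variables -/

lemma lintegral_mul_lintegral_Ioo {φ g : ℝ → ENNReal} (hφ : Measurable φ) (hg : Measurable g) :
    ∫⁻ x in Ioi 0, φ x * ∫⁻ y in Ioo 0 x, g y =
      ∫⁻ y in Ioi 0, g y * ∫⁻ x in Ioi y, φ x := by
  have hm : MeasurableSet {p : ℝ × ℝ | p.2 < p.1} := measurableSet_lt measurable_snd measurable_fst
  have key : Measurable (fun p : ℝ × ℝ => {p : ℝ × ℝ | p.2 < p.1}.indicator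
      (fun p => φ p.1 * g p.2) p) := Measurable.indicator (by fun_prop) hm
  calc ∫⁻ x in Ioi 0, φ x * ∫⁻ y in Ioo 0 x, g y
      = ∫⁻ x in Ioi 0, ∫⁻ y in Ioi 0, {p : ℝ × ℝ | p.2 < p.1}.indicator
          (fun p => φ p.1 * g p.2) (x, y) := by
        refine lintegral_congr fun x => ?_
        rw [← lintegral_const_mul _ hg, ← Ioi_inter_Iio, inter_comm,
          ← Measure.restrict_restrict measurableSet_Iio, ← lintegral_indicator measurableSet_Iio]
        refine lintegral_congr fun y => ?_
        by_cases h : y < x <;> simp [indicator, h]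
    _ = ∫⁻ y in Ioi 0, ∫⁻ x in Ioi 0, {p : ℝ × ℝ | p.2 < p.1}.indicator
          (fun p => φ p.1 * g p.2) (x, y) := lintegral_lintegral_swap key.aemeasurable
    _ = _ := by
        refine setLIntegral_congr_fun measurableSet_Ioi fun y hy => ?_
        have hs : Ioi y = Ioi y ∩ Ioi 0 :=
          (inter_eq_left.2 (Ioi_subset_Ioi (le_of_lt hy))).symm
        rw [← lintegral_const_mul _ hφ, hs, ← Measure.restrict_restrict measurableSet_Ioi,
          ← lintegral_indicator (s := Ioi y) measurableSet_Ioi]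
        refine lintegral_congr fun x => ?_
        by_cases h : y < x <;> simp [indicator, h, mul_comm]

/-- Tonelli in three variables: the constraints `y < x` and `z > x - y` say that `x` lies in `(y, y
+ z)`. -/
lemma lintegral_mul_lintegral_lintegral {φ : ℝ → ENNReal} {h : ℝ → ℝ → ENNReal}
    (hφ : Measurable φ) (hh : Measurable (fun p : ℝ × ℝ => h p.1 p.2)) :
    ∫⁻ x in Ioi 0, φ x * ∫⁻ y in Ioo 0 x, ∫⁻ z in Ioi (x - y), h y z =
      ∫⁻ y in Ioi 0, ∫⁻ z in Ioi 0, h y z * ∫⁻ x in Ioo y (y + z), φ x := by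
  set S : Set (ℝ × ℝ × ℝ) := {p | p.2.1 < p.1 ∧ p.1 < p.2.1 + p.2.2} with hS
  have hSm : MeasurableSet S := by
    rw [hS, ofPred_and]
    exact MeasurableSet.inter (measurableSet_lt (by fun_prop) (by fun_prop))
      (measurableSet_lt (by fun_prop) (by fun_prop))
  set G : ℝ × ℝ × ℝ → ENNReal := S.indicator (fun p => φ p.1 * h p.2.1 p.2.2) with hG
  have hGm : Measurable G := by
    refine Measurable.indicator ?_ hSm
    exact (hφ.comp measurable_fst).mul (hh.comp measurable_snd)
  have hh' : ∀ y, Measurable (h y) := fun y => hh.comp (measurable_const.prodMk measurable_id)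
  have hinner : Measurable fun p : ℝ × ℝ => ∫⁻ z in Ioi 0, G (p.1, p.2, z) := by
    have : Measurable fun r : (ℝ × ℝ) × ℝ => G (r.1.1, r.1.2, r.2) := hGm.comp (by fun_prop)
    exact this.lintegral_prod_right'
  calc ∫⁻ x in Ioi 0, φ x * ∫⁻ y in Ioo 0 x, ∫⁻ z in Ioi (x - y), h y z
      = ∫⁻ x in Ioi 0, ∫⁻ y in Ioi 0, ∫⁻ z in Ioi 0, G (x, y, z) := by
        refine lintegral_congr fun x => ?_
        have e1 : ∫⁻ y in Ioo 0 x, ∫⁻ z in Ioi (x - y), h y z =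
            ∫⁻ y in Ioi 0, (Iio x).indicator (fun y => ∫⁻ z in Ioi 0,
              (Ioi (x - y)).indicator (h y) z) y := by
          rw [lintegral_indicator measurableSet_Iio,
            Measure.restrict_restrict measurableSet_Iio, inter_comm, Ioi_inter_Iio]
          refine setLIntegral_congr_fun measurableSet_Ioo fun y hy => ?_
          rw [lintegral_indicator measurableSet_Ioi, Measure.restrict_restrict measurableSet_Ioi,
            inter_eq_left.2 (Ioi_subset_Ioi (by linarith [hy.2]))]
        have hm1 : Measurable fun y => (Iio x).indicator (fun y => ∫⁻ z in Ioi 0,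
            (Ioi (x - y)).indicator (h y) z) y := by
          refine Measurable.indicator ?_ measurableSet_Iio
          have : Measurable fun p : ℝ × ℝ => {p : ℝ × ℝ | x - p.1 < p.2}.indicator
              (fun p => h p.1 p.2) p :=
            hh.indicator (measurableSet_lt (by fun_prop) (by fun_prop))
          exact this.lintegral_prod_right'
        rw [e1, ← lintegral_const_mul _ hm1]
        refine lintegral_congr fun y => ?_
        by_cases hyx : y < x
        · rw [indicator_of_mem (by exact hyx),
            ← lintegral_const_mul _ ((hh' y).indicator measurableSet_Ioi)]
          refine lintegral_congr fun z => ?_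
          by_cases hz : x < y + z
          · have : x - y < z := by linarith
            simp [hG, hS, indicator, hyx, hz, this]
          · have : ¬ x - y < z := by linarith
            simp [hG, hS, indicator, hz, this]
        · simp [hG, hS, indicator, hyx]
    _ = ∫⁻ y in Ioi 0, ∫⁻ x in Ioi 0, ∫⁻ z in Ioi 0, G (x, y, z) :=
        lintegral_lintegral_swap hinner.aemeasurable
    _ = ∫⁻ y in Ioi 0, ∫⁻ z in Ioi 0, ∫⁻ x in Ioi 0, G (x, y, z) := by
        refine lintegral_congr fun y => lintegral_lintegral_swap ?_
        exact (hGm.comp (by fun_prop : Measurable fun p : ℝ × ℝ => (p.1, y, p.2))).aemeasurable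
    _ = _ := by
        refine setLIntegral_congr_fun measurableSet_Ioi fun y hy => ?_
        refine lintegral_congr fun z => ?_
        have hy' : (0 : ℝ) < y := hy
        have hs : Ioo y (y + z) = Ioo y (y + z) ∩ Ioi 0 :=
          (inter_eq_left.2 fun x hx => hy'.trans hx.1).symm
        rw [← lintegral_const_mul _ hφ, hs, ← Measure.restrict_restrict measurableSet_Ioo,
          ← lintegral_indicator measurableSet_Ioo]
        refine lintegral_congr fun x => ?_
        by_cases h1 : y < x <;> by_cases h2 : x < y + z <;>
          simp [hG, hS, indicator, h1, h2, mul_comm]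

/-- The profile equation in Laplace variables, in `[0,∞]`. -/
lemma laplace_equation {ρ q : ℝ} (hq : 0 < q) {F : ℝ → ENNReal} (hF : Measurable F)
    {k : ℝ → ℝ → ENNReal} (hk : Measurable fun p : ℝ × ℝ => k p.1 p.2)
    (hsymm : ∀ y z, k y z = k z y)
    (heq : ∀ᵐ x ∂volume.restrict (Ioi (0 : ℝ)), ENNReal.ofReal (x ^ 2) * F x =
      ENNReal.ofReal (1 - ρ) * (∫⁻ y in Ioo 0 x, ENNReal.ofReal y * F y) +
      ∫⁻ y in Ioo 0 x, ∫⁻ z in Ioi (x - y), ENNReal.ofReal y * k y z * F y * F z) :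
    2 * ∫⁻ x in Ioi 0, F x *
        ENNReal.ofReal (1 - Real.exp (-(q * x)) - q * x * Real.exp (-(q * x))) =
      2 * (ENNReal.ofReal (1 - ρ) * ∫⁻ x in Ioi 0, F x * ENNReal.ofReal (1 - Real.exp (-(q * x)))) +
      ∫⁻ y in Ioi 0, ∫⁻ z in Ioi 0, k y z * (F y * ENNReal.ofReal (1 - Real.exp (-(q * y)))) *
        (F z * ENNReal.ofReal (1 - Real.exp (-(q * z)))) := by
  set φ : ℝ → ENNReal := fun x => ENNReal.ofReal (weight q x) with hφdef
  have hφ : Measurable φ := (measurable_weight q).ennreal_ofReal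
  set h : ℝ → ℝ → ENNReal := fun y z => ENNReal.ofReal y * k y z * F y * F z with hhdef
  have hh : Measurable fun p : ℝ × ℝ => h p.1 p.2 := by
    have h1 : Measurable fun p : ℝ × ℝ => ENNReal.ofReal p.1 := by fun_prop
    exact ((h1.mul hk).mul (hF.comp measurable_fst)).mul (hF.comp measurable_snd)
  have hg : Measurable fun y => ENNReal.ofReal y * F y := by fun_prop
  have hL : ∫⁻ x in Ioi 0, F x *
        ENNReal.ofReal (1 - Real.exp (-(q * x)) - q * x * Real.exp (-(q * x))) =
      ∫⁻ x in Ioi 0, φ x * (ENNReal.ofReal (x ^ 2) * F x) := by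
    refine setLIntegral_congr_fun measurableSet_Ioi fun x hx => ?_
    have hx' : (0 : ℝ) < x := hx
    have : ENNReal.ofReal (1 - Real.exp (-(q * x)) - q * x * Real.exp (-(q * x))) =
        φ x * ENNReal.ofReal (x ^ 2) := by
      simp only [hφdef]
      rw [ ← ENNReal.ofReal_mul (weight_nonneg q x), weight,
        div_mul_cancel₀ _ (pow_ne_zero 2 hx'.ne')]
    rw [this]; ring
  have hA : ∫⁻ x in Ioi 0, φ x * (ENNReal.ofReal (1 - ρ) *
        (∫⁻ y in Ioo 0 x, ENNReal.ofReal y * F y)) =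
      ENNReal.ofReal (1 - ρ) * ∫⁻ x in Ioi 0, F x * ENNReal.ofReal (1 - Real.exp (-(q * x))) := by
    simp_rw [mul_left_comm (φ _)]
    rw [lintegral_const_mul' _ _ ENNReal.ofReal_ne_top, lintegral_mul_lintegral_Ioo hφ hg]
    congr 1
    refine setLIntegral_congr_fun measurableSet_Ioi fun y hy => ?_
    have hy' : (0 : ℝ) < y := hy
    simp only [hφdef]
    rw [lintegral_weight_Ioi hq hy', mul_comm (ENNReal.ofReal y), mul_assoc,
      ← ENNReal.ofReal_mul hy'.le, mul_div_cancel₀ _ hy'.ne']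
  have hAm : Measurable fun x => φ x * (ENNReal.ofReal (1 - ρ) *
        (∫⁻ y in Ioo 0 x, ENNReal.ofReal y * F y)) := by
    refine hφ.mul (Measurable.const_mul ?_ _)
    have hm : MeasurableSet {p : ℝ × ℝ | 0 < p.2 ∧ p.2 < p.1} := by
      rw [ofPred_and]
      exact MeasurableSet.inter (measurableSet_lt (by fun_prop) (by fun_prop))
        (measurableSet_lt (by fun_prop) (by fun_prop))
    convert ((hg.comp measurable_snd).indicator hm).lintegral_prod_right' (ν := volume) using 2
      with x
    rw [← lintegral_indicator measurableSet_Ioo]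
    rfl
  -- The integrand `D` is not symmetric in `y, z`. Only `D y z + D z y` factorises, since the
  -- weights `y/(y+z)` and `z/(y+z)` sum to one; hence the factor 2 in the statement.
  set D : ℝ → ℝ → ENNReal := fun y z => h y z * ∫⁻ x in Ioo y (y + z), φ x with hDdef
  have hB := lintegral_mul_lintegral_lintegral hφ hh
  have hDval : ∀ y > 0, ∀ z > 0, D y z = k y z * F y * F z * ENNReal.ofReal
      ((1 - Real.exp (-(q * y))) - y / (y + z) * (1 - Real.exp (-(q * (y + z))))) := by
    intro y hy z hz
    simp only [hDdef, hhdef, hφdef]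
    rw [lintegral_weight_Ioo hq hy hz]
    have : ENNReal.ofReal ((1 - Real.exp (-(q * y))) - y / (y + z) * (1 - Real.exp (-(q * (y + z))))) =
        ENNReal.ofReal y * ENNReal.ofReal ((1 - Real.exp (-(q * y))) / y
        - (1 - Real.exp (-(q * (y + z)))) / (y + z)) := by
      rw [← ENNReal.ofReal_mul hy.le]; congr 1; field_simp
    rw [this]; ring
  -- Nonnegativity is needed to add the two `ENNReal.ofReal` terms without truncation.
  have hnn : ∀ y > 0, ∀ z > 0,
      0 ≤ (1 - Real.exp (-(q * y))) - y / (y + z) * (1 - Real.exp (-(q * (y + z)))) := by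
    intro y hy z hz
    have h1 : Real.exp (-(q * (y + z))) = Real.exp (-(q * y)) * Real.exp (-(q * z)) := by
      rw [← Real.exp_add]; ring_nf
    have h2 := Real.one_sub_le_exp_neg (q * z)
    have h3 := weight_numerator_nonneg (q := q) (x := y)
    have h4 : y * Real.exp (-(q * y)) * (1 - Real.exp (-(q * z))) ≤
        y * Real.exp (-(q * y)) * (q * z) := by
      gcongr; linarith
    have h5 : 0 < y + z := add_pos hy hz
    rw [sub_nonneg, div_mul_eq_mul_div, div_le_iff₀ h5, h1]
    nlinarith [mul_nonneg hz.le h3]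
  have hDsum : ∀ y > 0, ∀ z > 0, D y z + D z y =
      k y z * (F y * ENNReal.ofReal (1 - Real.exp (-(q * y)))) *
        (F z * ENNReal.ofReal (1 - Real.exp (-(q * z)))) := by
    intro y hy z hz
    rw [hDval y hy z hz, hDval z hz y hy, hsymm z y, mul_right_comm (k y z) (F z), ← mul_add,
      ← ENNReal.ofReal_add (hnn y hy z hz) (hnn z hz y hy)]
    have : (1 - Real.exp (-(q * y))) - y / (y + z) * (1 - Real.exp (-(q * (y + z)))) +
        ((1 - Real.exp (-(q * z))) - z / (z + y) * (1 - Real.exp (-(q * (z + y))))) =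
        (1 - Real.exp (-(q * y))) * (1 - Real.exp (-(q * z))) := by
      have h1 : Real.exp (-(q * (y + z))) = Real.exp (-(q * y)) * Real.exp (-(q * z)) := by
        rw [← Real.exp_add]; ring_nf
      rw [add_comm z y, h1]
      have : y + z ≠ 0 := by positivity
      field_simp
      ring
    rw [this, ENNReal.ofReal_mul (one_sub_exp_nonneg hq.le hy.le)]
    ring
  have hDm : Measurable fun p : ℝ × ℝ => D p.1 p.2 := by
    refine hh.mul ?_
    have hm : MeasurableSet {r : (ℝ × ℝ) × ℝ | r.1.1 < r.2 ∧ r.2 < r.1.1 + r.1.2} := by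
      rw [ofPred_and]
      exact MeasurableSet.inter (measurableSet_lt (by fun_prop) (by fun_prop))
        (measurableSet_lt (by fun_prop) (by fun_prop))
    convert ((hφ.comp measurable_snd).indicator hm).lintegral_prod_right' (ν := volume) using 2
      with p
    rw [← lintegral_indicator measurableSet_Ioo]
    rfl
  have hDsymm : 2 * ∫⁻ y in Ioi 0, ∫⁻ z in Ioi 0, D y z =
      ∫⁻ y in Ioi 0, ∫⁻ z in Ioi 0, k y z * (F y * ENNReal.ofReal (1 - Real.exp (-(q * y)))) *
        (F z * ENNReal.ofReal (1 - Real.exp (-(q * z)))) := by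
    have hsw : ∫⁻ y in Ioi (0 : ℝ), ∫⁻ z in Ioi (0 : ℝ), D y z =
        ∫⁻ y in Ioi 0, ∫⁻ z in Ioi 0, D z y :=
      lintegral_lintegral_swap hDm.aemeasurable
    rw [two_mul]
    nth_rw 2 [hsw]
    rw [← lintegral_add_left hDm.lintegral_prod_right']
    refine setLIntegral_congr_fun measurableSet_Ioi fun y hy => ?_
    have hDy : Measurable (D y) := hDm.comp (measurable_const.prodMk measurable_id)
    change (∫⁻ z in Ioi 0, D y z) + ∫⁻ z in Ioi 0, D z y = _
    rw [← lintegral_add_left hDy]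
    exact setLIntegral_congr_fun measurableSet_Ioi fun z hz => hDsum y hy z hz
  rw [hL, ← hDsymm, ← mul_add, ← hA, hDdef, ← hB, ← lintegral_add_left hAm]
  congr 1
  refine lintegral_congr_ae ?_
  filter_upwards [heq] with x hx
  rw [hx, mul_add]

/-! ### Comparison for the Riccati equation -/

/-- Passing to `1/Q` linearises the Bernoulli equation: `q^ρ/Q - q^ρ/ρ` has derivative `q^(ρ-1) E/Q²
≥ 0` and limit `1/ρ` at `0`, so it stays above `1/ρ`. -/
lemma le_of_riccati {ρ : ℝ} (hρ : 0 < ρ) {Q E : ℝ → ℝ}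
    (hd : ∀ q > 0, HasDerivAt Q ((ρ * Q q - Q q ^ 2 - E q) / q) q) (hE : ∀ q > 0, 0 ≤ E q)
    (hpos : ∀ q > 0, 0 < Q q) (hlim : Tendsto (fun q => Q q / q ^ ρ) (𝓝[>] 0) (𝓝 ρ))
    {q : ℝ} (hq : 0 < q) : Q q ≤ ρ * q ^ ρ / (1 + q ^ ρ) := by
  set G : ℝ → ℝ := fun q => q ^ ρ / Q q - q ^ ρ / ρ with hG
  have hGd : ∀ q > 0, HasDerivAt G (q ^ (ρ - 1) * (E q / Q q ^ 2)) q := by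
    intro q hq
    have h1 := Real.hasDerivAt_rpow_const (p := ρ) (Or.inl hq.ne')
    refine ((h1.div (hd q hq) (hpos q hq).ne').sub (h1.div_const ρ)).congr_deriv ?_
    have h2 : q ^ ρ = q ^ (ρ - 1) * q := by
      rw [← Real.rpow_add_one hq.ne']; ring_nf
    have := (hpos q hq).ne'
    rw [h2]
    field_simp
    ring
  have hmono : MonotoneOn G (Ioi 0) := by
    refine monotoneOn_of_deriv_nonneg (convex_Ioi 0)
      (fun q hq => (hGd q hq).continuousAt.continuousWithinAt)
      (fun q hq => (hGd q (by simpa using hq)).differentiableAt.differentiableWithinAt) ?_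
    intro q hq
    have hq : 0 < q := by simpa using hq
    rw [(hGd q hq).deriv]
    have := hE q hq
    positivity
  have hrpow : Tendsto (fun q : ℝ => q ^ ρ) (𝓝[>] 0) (𝓝 0) := by
    have := (Real.continuousAt_rpow_const 0 ρ (Or.inr hρ.le)).tendsto
    rw [Real.zero_rpow hρ.ne'] at this
    exact this.mono_left nhdsWithin_le_nhds
  have hGlim : Tendsto G (𝓝[>] 0) (𝓝 (ρ⁻¹ - 0 / ρ)) := by
    refine Tendsto.sub ?_ (hrpow.div_const ρ)
    simpa using hlim.inv₀ hρ.ne'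
  have hle : ρ⁻¹ - 0 / ρ ≤ G q := by
    refine le_of_tendsto hGlim ?_
    filter_upwards [Ioo_mem_nhdsGT hq] with s hs
    exact hmono hs.1 hq hs.2.le
  have hQ := hpos q hq
  have ht : 0 < q ^ ρ := Real.rpow_pos_of_pos hq _
  rw [le_div_iff₀ (by positivity)]
  have h3 : ρ⁻¹ + q ^ ρ / ρ ≤ q ^ ρ / Q q := by
    simp only [hG] at hle; simp only [zero_div, sub_zero] at hle; linarith
  have h4 : (1 + q ^ ρ) / ρ ≤ q ^ ρ / Q q := by
    rw [add_div, one_div]; exact h3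
  rw [div_le_div_iff₀ hρ hQ] at h4
  linarith

/-- Dividing by `q^ρ` removes the linear term. The gap between `Q̄/q^ρ` and `Q/q^ρ` grows at rate at
most `E/q^(ρ+1) ≤ c q^(η-1)`, because `Q ≤ Q̄` makes the quadratic terms contribute with a
favourable sign. Integrating from `0`, where the gap vanishes, gives `(c/η) q^η`. -/
lemma ge_of_riccati {ρ c η : ℝ} (hρ : 0 < ρ) (hη : 0 < η) {Q E : ℝ → ℝ}
    (hd : ∀ q > 0, HasDerivAt Q ((ρ * Q q - Q q ^ 2 - E q) / q) q)
    (hE : ∀ q > 0, E q ≤ c * q ^ (ρ + η))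
    (hpos : ∀ q > 0, 0 < Q q) (hlim : Tendsto (fun q => Q q / q ^ ρ) (𝓝[>] 0) (𝓝 ρ))
    (hle : ∀ q > 0, Q q ≤ ρ * q ^ ρ / (1 + q ^ ρ))
    {q : ℝ} (hq : 0 < q) : ρ * q ^ ρ / (1 + q ^ ρ) - c / η * q ^ (ρ + η) ≤ Q q := by
  set G : ℝ → ℝ := fun q => ρ / (1 + q ^ ρ) - Q q / q ^ ρ - c / η * q ^ η with hG
  have hGd : ∀ q > 0, HasDerivAt G (q⁻¹ * (-(ρ ^ 2 * q ^ ρ / (1 + q ^ ρ) ^ 2)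
      + (Q q ^ 2 + E q) / q ^ ρ - c * q ^ η)) q := by
    intro q hq
    have ht : 0 < q ^ ρ := Real.rpow_pos_of_pos hq _
    have h1 := Real.hasDerivAt_rpow_const (p := ρ) (Or.inl hq.ne')
    have h1' := Real.hasDerivAt_rpow_const (p := η) (Or.inl hq.ne')
    have ht1 : 1 + q ^ ρ ≠ 0 := by positivity
    refine ((((hasDerivAt_const q ρ).div (h1.const_add 1) ht1).sub
      ((hd q hq).div h1 ht.ne')).sub (h1'.const_mul (c / η))).congr_deriv ?_
    have h2 : q ^ (ρ - 1) = q ^ ρ / q := Real.rpow_sub_one hq.ne' _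
    have h2' : q ^ (η - 1) = q ^ η / q := Real.rpow_sub_one hq.ne' _
    rw [h2, h2']
    field_simp
    ring
  have hmono : AntitoneOn G (Ioi 0) := by
    refine antitoneOn_of_deriv_nonpos (convex_Ioi 0)
      (fun q hq => (hGd q hq).continuousAt.continuousWithinAt)
      (fun q hq => (hGd q (by simpa using hq)).differentiableAt.differentiableWithinAt) ?_
    intro q hq
    have hq : 0 < q := by simpa using hq
    rw [(hGd q hq).deriv]
    have ht : 0 < q ^ ρ := Real.rpow_pos_of_pos hq _
    refine mul_nonpos_of_nonneg_of_nonpos (by positivity) ?_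
    have h1 : E q / q ^ ρ ≤ c * q ^ η := by
      rw [div_le_iff₀ ht, mul_assoc, ← Real.rpow_add hq, add_comm η]; exact hE q hq
    have h2 : Q q ^ 2 / q ^ ρ ≤ ρ ^ 2 * q ^ ρ / (1 + q ^ ρ) ^ 2 := by
      rw [div_le_iff₀ ht]
      calc Q q ^ 2 ≤ (ρ * q ^ ρ / (1 + q ^ ρ)) ^ 2 :=
            pow_le_pow_left₀ (hpos q hq).le (hle q hq) 2
        _ = _ := by field_simp
    rw [add_div]
    linarith
  have hrpow : ∀ p : ℝ, 0 < p → Tendsto (fun q : ℝ => q ^ p) (𝓝[>] 0) (𝓝 0) := by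
    intro p hp
    have := (Real.continuousAt_rpow_const 0 p (Or.inr hp.le)).tendsto
    rw [Real.zero_rpow hp.ne'] at this
    exact this.mono_left nhdsWithin_le_nhds
  have hGlim : Tendsto G (𝓝[>] 0) (𝓝 (ρ / (1 + 0) - ρ - c / η * 0)) :=
    ((tendsto_const_nhds.div ((hrpow ρ hρ).const_add 1) (by norm_num)).sub hlim).sub
      ((hrpow η hη).const_mul _)
  have hle : G q ≤ ρ / (1 + 0) - ρ - c / η * 0 := by
    refine ge_of_tendsto hGlim ?_
    filter_upwards [Ioo_mem_nhdsGT hq] with s hs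
    exact hmono hs.1 hq hs.2.le
  have ht : 0 < q ^ ρ := Real.rpow_pos_of_pos hq _
  have h3 : ρ / (1 + q ^ ρ) - c / η * q ^ η ≤ Q q / q ^ ρ := by
    simp only [hG, add_zero, div_one, mul_zero, sub_self] at hle; linarith
  rw [le_div_iff₀ ht] at h3
  rw [Real.rpow_add hq]
  calc _ = (ρ / (1 + q ^ ρ) - c / η * q ^ η) * q ^ ρ := by ring
    _ ≤ _ := h3

/-! ### From the tail of a density to its Laplace transform at zero -/

/-- Abelian theorem for the Laplace transform. -/
lemma tendsto_laplace_mul_rpow {g : ℝ → ℝ} (hg : Measurable g) (hg0 : ∀ x > 0, 0 ≤ g x)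
    (hgi : ∀ R, IntegrableOn g (Ioo 0 R)) {c s : ℝ} (hs : 0 < s)
    (hc : Tendsto (fun R => (∫ y in Ioo 0 R, g y) / R ^ s) atTop (𝓝 c)) :
    Tendsto (fun q => (∫ x in Ioi 0, g x * Real.exp (-(q * x))) * q ^ s) (𝓝[>] 0)
      (𝓝 (c * Real.Gamma (s + 1))) := by
  set M : ℝ → ℝ := fun R => ∫ y in Ioo 0 R, g y with hM
  have hnn : ∀ R, 0 ≤ᵐ[volume.restrict (Ioo 0 R)] g := fun R =>
    (ae_restrict_iff' measurableSet_Ioo).2 (ae_of_all _ fun x hx => hg0 x hx.1)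
  have hMmono : Monotone M := fun a b hab =>
    setIntegral_mono_set (hgi b) (hnn b) (Ioo_subset_Ioo_right hab).eventuallyLE
  have hM0 : ∀ R, 0 ≤ M R := fun R => integral_nonneg_of_ae (hnn R)
  have hMl : ∀ R, ∫⁻ y in Ioo 0 R, ENNReal.ofReal (g y) = ENNReal.ofReal (M R) := fun R =>
    (ofReal_integral_eq_lintegral_ofReal (hgi R) (hnn R)).symm
  have hexp : ∀ q > 0, ∀ y, ∫⁻ x in Ioi y, ENNReal.ofReal (q * Real.exp (-(q * x))) =
      ENNReal.ofReal (Real.exp (-(q * y))) := by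
    intro q hq y
    have hd : ∀ x ∈ Ici y, HasDerivAt (fun x => -Real.exp (-(q * x)))
        (q * Real.exp (-(q * x))) x := by
      intro x _
      have h := (((hasDerivAt_id x).const_mul q).fun_neg.exp).fun_neg
      refine h.congr_deriv ?_
      simp only [id]; ring
    have hp : ∀ x, 0 ≤ q * Real.exp (-(q * x)) := fun x => by positivity
    have hl : Tendsto (fun x => -Real.exp (-(q * x))) atTop (𝓝 0) := by
      have : Tendsto (fun x => -(q * x)) atTop atBot :=
        tendsto_neg_atTop_atBot.comp (tendsto_id.const_mul_atTop hq)
      simpa using (Real.tendsto_exp_atBot.comp this).neg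
    rw [← ofReal_integral_eq_lintegral_ofReal
      (integrableOn_Ioi_deriv_of_nonneg' hd (fun x _ => hp x) hl) (ae_of_all _ hp),
      integral_Ioi_of_hasDerivAt_of_nonneg' hd (fun x _ => hp x) hl]
    simp
  -- Integration by parts, done as Tonelli with `e^{-qy} = ∫_y^∞ q e^{-qx} dx`, followed by the
  -- scaling `u = q t`.
  have hrepr : ∀ q > 0, (∫ x in Ioi 0, g x * Real.exp (-(q * x))) * q ^ s =
      ∫ u in Ioi 0, Real.exp (-u) * (M (u / q) * q ^ s) := by
    intro q hq
    have h1 : ∫ x in Ioi 0, g x * Real.exp (-(q * x)) =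
        ∫ t in Ioi 0, q * Real.exp (-(q * t)) * M t := by
      rw [integral_eq_lintegral_of_nonneg_ae, integral_eq_lintegral_of_nonneg_ae]
      · congr 1
        have h := lintegral_mul_lintegral_Ioo
          (φ := fun t => ENNReal.ofReal (q * Real.exp (-(q * t)))) (by fun_prop)
          hg.ennreal_ofReal
        simp only [hMl, hexp q hq] at h
        calc _ = ∫⁻ y in Ioi 0, ENNReal.ofReal (g y) * ENNReal.ofReal (Real.exp (-(q * y))) :=
              setLIntegral_congr_fun measurableSet_Ioi fun y hy =>
                ENNReal.ofReal_mul (hg0 y hy)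
          _ = _ := by
              rw [← h]
              exact lintegral_congr fun y => (ENNReal.ofReal_mul (by positivity)).symm
      · exact ae_of_all _ fun x => mul_nonneg (by positivity) (hM0 x)
      · exact ((by fun_prop : Measurable fun t => q * Real.exp (-(q * t))).mul
          hMmono.measurable).aestronglyMeasurable
      · exact (ae_restrict_iff' measurableSet_Ioi).2
          (ae_of_all _ fun x hx => mul_nonneg (hg0 x hx) (Real.exp_pos _).le)
      · exact (hg.mul (by fun_prop)).aestronglyMeasurable
    have h2 := integral_comp_mul_left_Ioi (fun u => Real.exp (-u) * M (u / q)) 0 hq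
    rw [mul_zero] at h2
    simp_rw [← mul_assoc]
    rw [h1, integral_mul_const]
    congr 1
    simp_rw [mul_assoc, integral_const_mul]
    have h3 : ∀ t, q * t / q = t := fun t => mul_div_cancel_left₀ t hq.ne'
    simp only [h3] at h2
    rw [h2, smul_eq_mul, mul_inv_cancel_left₀ hq.ne']
  obtain ⟨R₀, hR₀, hbd⟩ : ∃ R₀ > 0, ∀ R ≥ R₀, M R ≤ (c + 1) * R ^ s := by
    have h1 := (hc.eventually_le_const (lt_add_one c)).and (eventually_gt_atTop 0)
    obtain ⟨R₀, h⟩ := eventually_atTop.1 h1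
    refine ⟨max R₀ 1, by positivity, fun R hR => ?_⟩
    have h2 := h R ((le_max_left _ _).trans hR)
    exact (div_le_iff₀ (Real.rpow_pos_of_pos h2.2 _)).1 h2.1
  have hc0 : 0 ≤ c := ge_of_tendsto hc (by
    filter_upwards [eventually_gt_atTop 0] with R hR
    exact div_nonneg (hM0 R) (Real.rpow_nonneg hR.le _))
  -- The additive constant covers small `R`, where the asymptotics say nothing; this gives a
  -- dominating function uniform in `q < 1`.
  have hbd' : ∀ R > 0, M R ≤ (c + 1) * R ^ s + M R₀ := by
    intro R hR
    rcases le_total R₀ R with h | h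
    · linarith [hbd R h, hM0 R₀]
    · have : 0 ≤ (c + 1) * R ^ s := by positivity
      linarith [hMmono h]
  have hΓ : c * Real.Gamma (s + 1) = ∫ u in Ioi 0, Real.exp (-u) * (c * u ^ s) := by
    rw [Real.Gamma_eq_integral (by linarith), ← integral_const_mul]
    refine integral_congr_ae (ae_of_all _ fun u => ?_)
    simp only [add_sub_cancel_right]; ring
  rw [hΓ]
  have hGi : ∀ p : ℝ, 0 ≤ p → IntegrableOn (fun u => Real.exp (-u) * u ^ p) (Ioi 0) := by
    intro p hp
    have := Real.GammaIntegral_convergent (s := p + 1) (by linarith)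
    simpa using this
  refine Tendsto.congr' (f₁ := fun q => ∫ u in Ioi 0, Real.exp (-u) * (M (u / q) * q ^ s))
    ?_ ?_
  · filter_upwards [self_mem_nhdsWithin] with q hq
    exact (hrepr q hq).symm
  refine tendsto_integral_filter_of_dominated_convergence
    (fun u => (c + 1) * (Real.exp (-u) * u ^ s) + M R₀ * (Real.exp (-u) * u ^ (0 : ℝ))) ?_ ?_ ?_ ?_
  · refine Eventually.of_forall fun q => ?_
    exact ((by fun_prop : Measurable fun u : ℝ => Real.exp (-u)).mul
      ((hMmono.measurable.comp (by fun_prop)).mul_const _)).aestronglyMeasurable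
  · filter_upwards [Ioo_mem_nhdsGT (one_pos (α := ℝ))] with q hq
    refine (ae_restrict_iff' measurableSet_Ioi).2 (ae_of_all _ fun u hu => ?_)
    have hu : 0 < u := hu
    have hq0 := hq.1
    have h1 := hbd' (u / q) (div_pos hu hq.1)
    have h2 : q ^ s ≤ 1 := Real.rpow_le_one hq.1.le hq.2.le hs.le
    have h3 : 0 < q ^ s := Real.rpow_pos_of_pos hq.1 _
    have h4 := hM0 R₀
    have h5 : M (u / q) * q ^ s ≤ (c + 1) * u ^ s + M R₀ := by
      calc M (u / q) * q ^ s ≤ ((c + 1) * (u / q) ^ s + M R₀) * q ^ s := by gcongr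
        _ = (c + 1) * u ^ s + M R₀ * q ^ s := by
            rw [Real.div_rpow hu.le hq.1.le]; field_simp
        _ ≤ (c + 1) * u ^ s + M R₀ * 1 := by gcongr
        _ = _ := by ring
    rw [Real.norm_of_nonneg (mul_nonneg (Real.exp_pos _).le (mul_nonneg (hM0 _) h3.le)),
      Real.rpow_zero]
    calc _ ≤ Real.exp (-u) * ((c + 1) * u ^ s + M R₀) := by gcongr
      _ = _ := by ring
  · exact ((hGi s hs.le).const_mul _).add ((hGi 0 le_rfl).const_mul _)
  · refine (ae_restrict_iff' measurableSet_Ioi).2 (ae_of_all _ fun u hu => ?_)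
    have hu : 0 < u := hu
    refine Tendsto.const_mul _ ?_
    have h1 : Tendsto (fun q => u / q) (𝓝[>] 0) atTop :=
      (tendsto_inv_nhdsGT_zero (𝕜 := ℝ)).const_mul_atTop hu
    refine ((hc.comp h1).mul_const (u ^ s)).congr' ?_
    filter_upwards [self_mem_nhdsWithin] with q hq
    have hq : 0 < q := hq
    simp only [Function.comp]
    have := Real.rpow_pos_of_pos hu s
    have := Real.rpow_pos_of_pos hq s
    change M (u / q) / (u / q) ^ s * u ^ s = _
    rw [Real.div_rpow hu.le hq.le]
    field_simp

/-! ### The desingularised Laplace transform -/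

lemma one_sub_exp_le_one (q x : ℝ) : 1 - Real.exp (-(q * x)) ≤ 1 := by
  linarith [Real.exp_pos (-(q * x))]

lemma one_sub_exp_le_mul (q x : ℝ) : 1 - Real.exp (-(q * x)) ≤ q * x := by
  linarith [Real.one_sub_le_exp_neg (q * x)]

lemma mul_exp_neg_le {q x : ℝ} (hq : 0 < q) : x * Real.exp (-(q * x)) ≤ 1 / q := by
  have := weight_numerator_nonneg (q := q) (x := x)
  rw [le_div_iff₀ hq]
  nlinarith [Real.exp_pos (-(q * x))]

/-- Interpolates between the bounds `1` and `qx`; the free exponent `β` later distributes powers of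
`q` between the two factors of the perturbation term. -/
lemma one_sub_exp_le_rpow {β q x : ℝ} (hβ₀ : 0 ≤ β) (hβ₁ : β ≤ 1) (hq : 0 < q) (hx : 0 < x) :
    1 - Real.exp (-(q * x)) ≤ q ^ β * x ^ β := by
  rw [← Real.mul_rpow hq.le hx.le]
  have hqx : 0 < q * x := mul_pos hq hx
  rcases le_total (q * x) 1 with h | h
  · refine (one_sub_exp_le_mul q x).trans ?_
    simpa using Real.rpow_le_rpow_of_exponent_ge hqx h hβ₁
  · exact (one_sub_exp_le_one q x).trans (Real.one_le_rpow h hβ₀)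

/-- The desingularised Laplace transform `∫_0^∞ f(x) (1 - e^{-qx}) dx`. -/
noncomputable def desing (f : ℝ → ℝ) (q : ℝ) : ℝ :=
  ∫ x in Ioi 0, f x * (1 - Real.exp (-(q * x)))

/-- The derivative `∫_0^∞ x f(x) e^{-qx} dx` of the desingularised Laplace transform. -/
noncomputable def desingDeriv (f : ℝ → ℝ) (q : ℝ) : ℝ :=
  ∫ x in Ioi 0, x * f x * Real.exp (-(q * x))

/-- The integrability of a profile that makes its desingularised Laplace transform finite. -/
structure Admissible (f : ℝ → ℝ) : Prop where
  measurable : Measurable f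
  nonneg : ∀ x, 0 ≤ f x
  integrableOn_mul : IntegrableOn (fun x => x * f x) (Ioc 0 1)
  integrableOn : IntegrableOn f (Ioi 1)

lemma integrableOn_of_Ioc_Ioi {g : ℝ → ℝ} (h0 : IntegrableOn g (Ioc 0 1))
    (h1 : IntegrableOn g (Ioi 1)) : IntegrableOn g (Ioi 0) := by
  rw [← Ioc_union_Ioi_eq_Ioi (zero_le_one (α := ℝ))]
  exact h0.union h1

lemma integrableOn_mul_one_sub_exp {f : ℝ → ℝ} (hA : Admissible f) {q : ℝ} (hq : 0 ≤ q) :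
    IntegrableOn (fun x => f x * (1 - Real.exp (-(q * x)))) (Ioi 0) := by
  obtain ⟨hf, hf0, h0, h1⟩ := id hA
  have hm : Measurable fun x => f x * (1 - Real.exp (-(q * x))) := by fun_prop
  refine integrableOn_of_Ioc_Ioi ((h0.const_mul q).mono' hm.aestronglyMeasurable ?_)
    (h1.mono' hm.aestronglyMeasurable ?_)
  · refine (ae_restrict_iff' measurableSet_Ioc).2 (ae_of_all _ fun x hx => ?_)
    rw [Real.norm_of_nonneg (mul_nonneg (hf0 x) (one_sub_exp_nonneg hq hx.1.le))]
    nlinarith [mul_le_mul_of_nonneg_left (one_sub_exp_le_mul q x) (hf0 x)]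
  · refine (ae_restrict_iff' measurableSet_Ioi).2 (ae_of_all _ fun x hx => ?_)
    have hx : (0 : ℝ) ≤ x := zero_le_one.trans (le_of_lt hx)
    rw [Real.norm_of_nonneg (mul_nonneg (hf0 x) (one_sub_exp_nonneg hq hx))]
    exact mul_le_of_le_one_right (hf0 x) (one_sub_exp_le_one q x)

lemma integrableOn_mul_mul_exp {f : ℝ → ℝ} (hA : Admissible f) {q : ℝ} (hq : 0 < q) :
    IntegrableOn (fun x => x * f x * Real.exp (-(q * x))) (Ioi 0) := by
  obtain ⟨hf, hf0, h0, h1⟩ := id hA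
  have hm : Measurable fun x => x * f x * Real.exp (-(q * x)) := by fun_prop
  refine integrableOn_of_Ioc_Ioi (h0.mono' hm.aestronglyMeasurable ?_)
    ((h1.const_mul (1 / q)).mono' hm.aestronglyMeasurable ?_)
  · refine (ae_restrict_iff' measurableSet_Ioc).2 (ae_of_all _ fun x hx => ?_)
    have hxf : 0 ≤ x * f x := mul_nonneg hx.1.le (hf0 x)
    rw [Real.norm_of_nonneg (mul_nonneg hxf (Real.exp_pos _).le)]
    refine mul_le_of_le_one_right hxf (Real.exp_le_one_iff.2 ?_)
    nlinarith [mul_nonneg hq.le hx.1.le]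
  · refine (ae_restrict_iff' measurableSet_Ioi).2 (ae_of_all _ fun x hx => ?_)
    have hx : (0 : ℝ) ≤ x := zero_le_one.trans (le_of_lt hx)
    rw [Real.norm_of_nonneg (mul_nonneg (mul_nonneg hx (hf0 x)) (Real.exp_pos _).le)]
    nlinarith [mul_le_mul_of_nonneg_right (mul_exp_neg_le (x := x) hq) (hf0 x)]

lemma hasDerivAt_desing {f : ℝ → ℝ} (hA : Admissible f) {q : ℝ} (hq : 0 < q) : HasDerivAt (desing f) (desingDeriv f q) q := by
  obtain ⟨hf, hf0, h0, h1⟩ := id hA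
  have hball : Metric.ball q (q / 2) ∈ 𝓝 q := Metric.ball_mem_nhds _ (by positivity)
  refine (hasDerivAt_integral_of_dominated_loc_of_deriv_le
    (F := fun q x => f x * (1 - Real.exp (-(q * x))))
    (F' := fun q x => x * f x * Real.exp (-(q * x))) hball ?_
    (integrableOn_mul_one_sub_exp hA hq.le) ?_ ?_
    (integrableOn_mul_mul_exp hA (half_pos hq)) ?_).2
  · exact Eventually.of_forall fun p =>
      (by fun_prop : Measurable fun x => f x * (1 - Real.exp (-(p * x)))).aestronglyMeasurable
  · exact (by fun_prop : Measurable fun x => x * f x * Real.exp (-(q * x))).aestronglyMeasurable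
  · refine (ae_restrict_iff' measurableSet_Ioi).2 (ae_of_all _ fun x hx p hp => ?_)
    have hx : (0 : ℝ) < x := hx
    have hxf : 0 ≤ x * f x := mul_nonneg hx.le (hf0 x)
    rw [Real.norm_of_nonneg (mul_nonneg hxf (Real.exp_pos _).le)]
    have : q / 2 ≤ p := by
      have := abs_lt.1 (Real.dist_eq p q ▸ Metric.mem_ball.1 hp)
      linarith [this.1]
    gcongr
  · refine ae_of_all _ fun x p _ => ?_
    have h := ((((hasDerivAt_id p).mul_const x).fun_neg.exp).const_sub 1).const_mul (f x)
    refine h.congr_deriv ?_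
    simp only [id]; ring

lemma desing_nonneg {f : ℝ → ℝ} (hA : Admissible f) {q : ℝ} (hq : 0 ≤ q) : 0 ≤ desing f q :=
  setIntegral_nonneg measurableSet_Ioi fun x hx =>
    mul_nonneg (hA.nonneg x) (one_sub_exp_nonneg hq (le_of_lt hx))

lemma desing_mono {f : ℝ → ℝ} (hA : Admissible f) {p q : ℝ} (hp : 0 ≤ p) (hpq : p ≤ q) : desing f p ≤ desing f q := by
  obtain ⟨hf, hf0, h0, h1⟩ := id hA
  refine setIntegral_mono_on (integrableOn_mul_one_sub_exp hA hp)
    (integrableOn_mul_one_sub_exp hA (hp.trans hpq)) measurableSet_Ioi fun x hx => ?_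
  have hx : (0 : ℝ) < x := hx
  have := hf0 x
  gcongr

lemma tendsto_desing_zero {f : ℝ → ℝ} (hA : Admissible f) : Tendsto (desing f) (𝓝[>] 0) (𝓝 0) := by
  obtain ⟨hf, hf0, h0, h1⟩ := id hA
  have h : Tendsto (desing f) (𝓝[>] 0) (𝓝 (∫ x in Ioi 0, f x * (1 - Real.exp (-(0 * x))))) := by
    refine tendsto_integral_filter_of_dominated_convergence
      (fun x => f x * (1 - Real.exp (-(1 * x)))) ?_ ?_
      (integrableOn_mul_one_sub_exp hA zero_le_one) ?_
    · exact Eventually.of_forall fun p =>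
        (by fun_prop : Measurable fun x => f x * (1 - Real.exp (-(p * x)))).aestronglyMeasurable
    · filter_upwards [Ioo_mem_nhdsGT (one_pos (α := ℝ))] with q hq
      refine (ae_restrict_iff' measurableSet_Ioi).2 (ae_of_all _ fun x hx => ?_)
      have hx : (0 : ℝ) < x := hx
      have := hf0 x
      rw [Real.norm_of_nonneg (mul_nonneg this (one_sub_exp_nonneg hq.1.le hx.le))]
      have := hq.2.le
      gcongr
    · refine ae_of_all _ fun x => Tendsto.mono_left ?_ nhdsWithin_le_nhds
      exact (by fun_prop : Continuous fun q => f x * (1 - Real.exp (-(q * x)))).tendsto 0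
  simpa using h

lemma ofReal_desing {f : ℝ → ℝ} (hA : Admissible f) {q : ℝ} (hq : 0 ≤ q) :
    ENNReal.ofReal (desing f q) =
      ∫⁻ x in Ioi 0, ENNReal.ofReal (f x) * ENNReal.ofReal (1 - Real.exp (-(q * x))) := by
  obtain ⟨hf, hf0, h0, h1⟩ := id hA
  rw [desing, ofReal_integral_eq_lintegral_ofReal (integrableOn_mul_one_sub_exp hA hq)]
  · exact lintegral_congr fun x => ENNReal.ofReal_mul (hf0 x)
  · exact (ae_restrict_iff' measurableSet_Ioi).2 (ae_of_all _ fun x hx =>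
      mul_nonneg (hf0 x) (one_sub_exp_nonneg hq (le_of_lt hx)))

lemma ofReal_desing_sub {f : ℝ → ℝ} (hA : Admissible f) {q : ℝ} (hq : 0 < q) :
    ENNReal.ofReal (desing f q - q * desingDeriv f q) =
      ∫⁻ x in Ioi 0, ENNReal.ofReal (f x) *
        ENNReal.ofReal (1 - Real.exp (-(q * x)) - q * x * Real.exp (-(q * x))) := by
  obtain ⟨hf, hf0, h0, h1⟩ := id hA
  have hi1 := integrableOn_mul_one_sub_exp hA hq.le
  have hi2 := (integrableOn_mul_mul_exp hA hq).const_mul q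
  rw [desing, desingDeriv, ← integral_const_mul, ← integral_sub hi1 hi2,
    ofReal_integral_eq_lintegral_ofReal (by exact hi1.sub hi2)]
  · refine lintegral_congr fun x => ?_
    rw [← ENNReal.ofReal_mul (hf0 x)]; congr 1; ring
  · refine ae_of_all _ fun x => ?_
    have := mul_nonneg (hf0 x) (weight_numerator_nonneg (q := q) (x := x))
    simp only [Pi.zero_apply]
    linarith

/-- The Abelian theorem applied to `x f(x)` gives the behaviour of the derivative of `desing f`, and
l'Hôpital transfers it to `desing f`. The factor `Γ(2-ρ)` in the normalisation cancels, leaving the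
limit `ρ`. -/
lemma tendsto_desing_div_rpow {f : ℝ → ℝ} (hA : Admissible f) {ρ : ℝ} (hρ₀ : 0 < ρ) (hρ₁ : ρ < 1)
    (hfi : ∀ R, IntegrableOn (fun x => x * f x) (Ioo 0 R))
    (htail : Tendsto (fun R => (∫ y in Ioo 0 R, y * f y) / R ^ (1 - ρ)) atTop
      (𝓝 (ρ ^ 2 / Real.Gamma (2 - ρ)))) :
    Tendsto (fun q => desing f q / q ^ ρ) (𝓝[>] 0) (𝓝 ρ) := by
  obtain ⟨hf, hf0, h0, h1⟩ := id hA
  have hd := tendsto_laplace_mul_rpow (g := fun x => x * f x) (by fun_prop)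
    (fun x hx => mul_nonneg (le_of_lt hx) (hf0 x)) hfi (by linarith) htail
  have hΓ : ρ ^ 2 / Real.Gamma (2 - ρ) * Real.Gamma (1 - ρ + 1) = ρ * ρ := by
    have : Real.Gamma (2 - ρ) ≠ 0 := (Real.Gamma_pos_of_pos (by linarith)).ne'
    rw [show 1 - ρ + 1 = 2 - ρ by ring]; field_simp
  rw [hΓ] at hd
  have hrpow : Tendsto (fun q : ℝ => q ^ ρ) (𝓝[>] 0) (𝓝 0) := by
    have := (Real.continuousAt_rpow_const 0 ρ (Or.inr hρ₀.le)).tendsto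
    rw [Real.zero_rpow hρ₀.ne'] at this
    exact this.mono_left nhdsWithin_le_nhds
  refine HasDerivAt.lhopital_zero_nhdsGT (f' := desingDeriv f) (g' := fun q => ρ * q ^ (ρ - 1))
    ?_ ?_ ?_ (tendsto_desing_zero hA) hrpow ?_
  · filter_upwards [self_mem_nhdsWithin] with q hq using hasDerivAt_desing hA hq
  · filter_upwards [self_mem_nhdsWithin] with q hq
    exact Real.hasDerivAt_rpow_const (Or.inl (ne_of_gt hq))
  · filter_upwards [self_mem_nhdsWithin] with q hq
    exact mul_ne_zero hρ₀.ne' (Real.rpow_pos_of_pos hq _).ne'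
  · have := hd.div_const ρ
    rw [mul_div_cancel_left₀ _ hρ₀.ne'] at this
    refine this.congr' ?_
    filter_upwards [self_mem_nhdsWithin] with q hq
    have hq : 0 < q := hq
    have h2 : q ^ (1 - ρ) = (q ^ (ρ - 1))⁻¹ := by rw [← Real.rpow_neg hq.le]; ring_nf
    rw [h2]
    change desingDeriv f q * _ / ρ = _
    field_simp

/-! ### Moment bounds -/

/-- For `x ≥ 1`, keep only `s ∈ (1/x, 1)`: there `1 - e^{-sx} ≥ 1/2`, and `s^(-1-γ)` integrates to
`(x^γ - 1)/γ`. The summand `1` covers `x ≤ 1`. -/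
lemma rpow_le_lintegral {γ x : ℝ} (hγ : 0 < γ) (hx : 0 < x) :
    ENNReal.ofReal (x ^ γ) ≤ 1 + ENNReal.ofReal (2 * γ) * ∫⁻ s in Ioo 0 1,
      ENNReal.ofReal (s ^ (-1 - γ)) * ENNReal.ofReal (1 - Real.exp (-(s * x))) := by
  rcases le_total x 1 with h | h
  · refine le_add_right ?_
    rw [ENNReal.ofReal_le_one]
    exact Real.rpow_le_one hx.le h hγ.le
  have hx1 : x⁻¹ ≤ 1 := inv_le_one_of_one_le₀ h
  have hxi : 0 < x⁻¹ := inv_pos.2 hx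
  have hnot : (0 : ℝ) ∉ uIcc x⁻¹ 1 := by
    rw [uIcc_of_le hx1]; exact fun h => absurd h.1 (not_le.2 hxi)
  have hint : IntegrableOn (fun s : ℝ => s ^ (-1 - γ)) (Ioc x⁻¹ 1) := by
    rw [← intervalIntegrable_iff_integrableOn_Ioc_of_le hx1]
    exact intervalIntegral.intervalIntegrable_rpow (Or.inr hnot)
  have hval : ∫ s in Ioc x⁻¹ 1, s ^ (-1 - γ) = (x ^ γ - 1) / γ := by
    rw [← intervalIntegral.integral_of_le hx1,
      integral_rpow (Or.inr ⟨by linarith, hnot⟩), Real.one_rpow, Real.inv_rpow hx.le,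
      ← Real.rpow_neg hx.le]
    rw [show -1 - γ + 1 = -γ by ring, neg_neg, div_neg, ← neg_div, neg_sub]
  have hlow : ENNReal.ofReal ((x ^ γ - 1) / γ) * ENNReal.ofReal (1 / 2) ≤ ∫⁻ s in Ioo 0 1,
      ENNReal.ofReal (s ^ (-1 - γ)) * ENNReal.ofReal (1 - Real.exp (-(s * x))) := by
    rw [← hval, ofReal_integral_eq_lintegral_ofReal hint
      ((ae_restrict_iff' measurableSet_Ioc).2 (ae_of_all _ fun s hs =>
        Real.rpow_nonneg (hxi.le.trans hs.1.le) _)), setLIntegral_congr Ioo_ae_eq_Ioc.symm,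
      ← lintegral_mul_const' _ _ ENNReal.ofReal_ne_top]
    refine (setLIntegral_mono' measurableSet_Ioo fun s hs => ?_).trans
      (lintegral_mono_set (Ioo_subset_Ioo_left hxi.le))
    gcongr
    have h1 : 1 ≤ s * x := by
      have := mul_le_mul_of_nonneg_right hs.1.le hx.le
      rwa [inv_mul_cancel₀ hx.ne'] at this
    have h2 : Real.exp (-(s * x)) ≤ Real.exp (-1) := Real.exp_le_exp.2 (by linarith)
    have h3 : Real.exp (-1) ≤ 1 / 2 := by
      rw [Real.exp_neg, one_div]
      exact inv_anti₀ two_pos (by linarith [Real.add_one_le_exp 1])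
    linarith
  calc ENNReal.ofReal (x ^ γ)
      = 1 + ENNReal.ofReal (2 * γ) * (ENNReal.ofReal ((x ^ γ - 1) / γ) * ENNReal.ofReal (1 / 2)) := by
        have h1 : 1 ≤ x ^ γ := Real.one_le_rpow h hγ.le
        rw [← ENNReal.ofReal_mul (div_nonneg (by linarith) hγ.le),
          ← ENNReal.ofReal_mul (by positivity), ← ENNReal.ofReal_one,
          ← ENNReal.ofReal_add zero_le_one]
        · congr 1; field_simp; ring
        · have : 0 ≤ x ^ γ - 1 := by linarith
          positivity
    _ ≤ _ := by gcongr

/-- Moments of order `γ < ρ` are controlled by the desingularised Laplace transform. -/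
lemma exists_moment_bound {ρ γ : ℝ} (hγ : 0 < γ) (hγρ : γ < ρ) :
    ∃ C : ENNReal, C ≠ ⊤ ∧ ∀ F : ℝ → ENNReal, Measurable F →
      ∫⁻ x in Ioi 0, F x ≤ ENNReal.ofReal ρ →
      (∀ q > 0, ∫⁻ x in Ioi 0, F x * ENNReal.ofReal (1 - Real.exp (-(q * x))) ≤
        ENNReal.ofReal (ρ * q ^ ρ)) →
      ∫⁻ x in Ioi 0, ENNReal.ofReal (x ^ γ) * F x ≤ C := by
  refine ⟨ENNReal.ofReal ρ + ENNReal.ofReal (2 * γ) * ∫⁻ s in Ioo 0 1,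
    ENNReal.ofReal (s ^ (-1 - γ)) * ENNReal.ofReal (ρ * s ^ ρ), ?_, ?_⟩
  · refine ENNReal.add_ne_top.2 ⟨ENNReal.ofReal_ne_top,
      ENNReal.mul_ne_top ENNReal.ofReal_ne_top ?_⟩
    -- The assumption `γ < ρ` enters here: the power `s^(ρ-γ-1)` is integrable at `0`.
    have h : IntegrableOn (fun s : ℝ => s ^ (ρ - γ - 1)) (Ioc 0 1) := by
      rw [← intervalIntegrable_iff_integrableOn_Ioc_of_le zero_le_one]
      exact intervalIntegral.intervalIntegrable_rpow' (by linarith)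
    have hint : IntegrableOn (fun s : ℝ => ρ * s ^ (ρ - γ - 1)) (Ioo 0 1) :=
      (h.mono_set Ioo_subset_Ioc_self).const_mul ρ
    refine ne_of_eq_of_ne ?_ hint.lintegral_lt_top.ne
    refine setLIntegral_congr_fun measurableSet_Ioo fun s hs => ?_
    rw [← ENNReal.ofReal_mul (Real.rpow_nonneg hs.1.le _), mul_left_comm, ← Real.rpow_add hs.1]
    ring_nf
  · intro F hF hmass hQ
    have hm : Measurable fun p : ℝ × ℝ => F p.1 *
        (ENNReal.ofReal (p.2 ^ (-1 - γ)) * ENNReal.ofReal (1 - Real.exp (-(p.2 * p.1)))) := by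
      fun_prop
    calc ∫⁻ x in Ioi 0, ENNReal.ofReal (x ^ γ) * F x
        ≤ ∫⁻ x in Ioi 0, (F x + ENNReal.ofReal (2 * γ) * ∫⁻ s in Ioo 0 1, F x *
          (ENNReal.ofReal (s ^ (-1 - γ)) * ENNReal.ofReal (1 - Real.exp (-(s * x))))) := by
          refine setLIntegral_mono' measurableSet_Ioi fun x hx => ?_
          rw [lintegral_const_mul _ (by fun_prop)]
          refine (mul_le_mul_left (rpow_le_lintegral hγ hx) (F x)).trans_eq ?_
          ring
      _ = (∫⁻ x in Ioi 0, F x) + ENNReal.ofReal (2 * γ) * ∫⁻ s in Ioo 0 1, ∫⁻ x in Ioi 0, F x *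
          (ENNReal.ofReal (s ^ (-1 - γ)) * ENNReal.ofReal (1 - Real.exp (-(s * x)))) := by
          rw [lintegral_add_left hF, lintegral_const_mul' _ _ ENNReal.ofReal_ne_top,
            lintegral_lintegral_swap hm.aemeasurable]
      _ ≤ _ := by
          refine add_le_add hmass (mul_le_mul_right ?_ _)
          refine setLIntegral_mono' measurableSet_Ioo fun s hs => ?_
          simp_rw [mul_left_comm (F _)]
          rw [lintegral_const_mul _ (by fun_prop)]
          gcongr
          exact hQ s hs.1

/-! ### From profiles to the Riccati equation -/

lemma IsNormalisedProfile.congr {α ρ : ℝ} {K : ℝ → ℝ → ℝ} {f g : ℝ → ℝ}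
    (hf : IsNormalisedProfile α ρ K f) (hfg : f =ᵐ[volume.restrict (Ioi 0)] g) :
    IsNormalisedProfile α ρ K g := by
  have hsub : ∀ {s : Set ℝ}, s ⊆ Ioi 0 → f =ᵐ[volume.restrict s] g := fun hs =>
    ae_restrict_of_ae_restrict_of_subset hs hfg
  have hmul : ∀ R : ℝ, (fun y => y * f y) =ᵐ[volume.restrict (Ioo 0 R)] fun y => y * g y := by
    intro R
    filter_upwards [hsub (s := Ioo 0 R) fun x hx => hx.1] with y hy
    rw [hy]
  refine ⟨⟨?_, ?_, ?_, ?_, ?_, ?_⟩, ?_⟩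
  · rw [locallyIntegrableOn_iff isOpen_Ioi.isLocallyClosed]
    intro k hk hkc
    exact ((locallyIntegrableOn_iff isOpen_Ioi.isLocallyClosed).1 hf.locallyIntegrableOn
      k hk hkc).congr_fun_ae (hsub hk)
  · filter_upwards [hf.nonneg, hfg] with x h1 h2
    rwa [← h2]
  · intro h
    refine hf.ne_zero ?_
    filter_upwards [h, hfg] with x h1 h2
    rw [h2, h1]
  · filter_upwards [hf.equation, hfg] with x h1 h2
    rw [← h2, h1]
    congr 1
    · congr 1
      refine lintegral_congr_ae ?_
      filter_upwards [hmul x] with y hy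
      rw [hy]
    · refine lintegral_congr_ae ?_
      filter_upwards [hsub (s := Ioo 0 x) fun x hx => hx.1, ae_restrict_mem measurableSet_Ioo]
        with y hy hyx
      refine lintegral_congr_ae ?_
      filter_upwards [hsub (s := Ioi (x - y)) (Ioi_subset_Ioi (by linarith [hyx.2]))] with z hz
      rw [hy, hz]
  · have hIci : f =ᵐ[volume.restrict (Ici 0)] g := by
      rwa [← restrict_Ioi_eq_restrict_Ici]
    have hcl := (isClosed_Ici (a := (0 : ℝ))).isLocallyClosed
    rw [locallyIntegrableOn_iff hcl]
    intro k hk hkc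
    refine ((locallyIntegrableOn_iff hcl).1 hf.locallyIntegrableOn_mul k hk hkc).congr_fun_ae ?_
    filter_upwards [ae_restrict_of_ae_restrict_of_subset hk hIci] with x hx
    rw [hx]
  · refine hf.integrableOn_rpow_mul.congr_fun_ae ?_
    filter_upwards [hsub (s := Ioi 1) (Ioi_subset_Ioi zero_le_one)] with x hx
    rw [hx]
  · refine hf.tail.congr_left (Eventually.of_forall fun R => ?_)
    exact integral_congr_ae (hmul R)

/-- A profile is determined only almost everywhere, so it may be replaced by a measurable,
everywhere nonnegative representative. As `α ≥ 0`, finiteness of `∫_1^∞ x^α f` gives integrability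
at infinity. -/
lemma IsNormalisedProfile.exists_admissible {α ρ : ℝ} (hα : 0 ≤ α) {K : ℝ → ℝ → ℝ} {f : ℝ → ℝ}
    (hf : IsNormalisedProfile α ρ K f) :
    ∃ g, f =ᵐ[volume.restrict (Ioi 0)] g ∧ Admissible g ∧ IsNormalisedProfile α ρ K g := by
  have hm := hf.locallyIntegrableOn.aestronglyMeasurable
  set g : ℝ → ℝ := fun x => max (hm.mk f x) 0 with hg
  have hgm : Measurable g := hm.stronglyMeasurable_mk.measurable.max measurable_const
  have hfg : f =ᵐ[volume.restrict (Ioi 0)] g := by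
    filter_upwards [hm.ae_eq_mk, hf.nonneg] with x h1 h2
    rw [hg]; simp only
    rw [← h1, max_eq_left h2]
  have hg' := hf.congr hfg
  refine ⟨g, hfg, ⟨hgm, fun x => le_max_right _ _, ?_, ?_⟩, hg'⟩
  · exact (hg'.locallyIntegrableOn_mul.integrableOn_compact_subset Icc_subset_Ici_self
      isCompact_Icc).mono_set Ioc_subset_Icc_self
  · refine hg'.integrableOn_rpow_mul.mono' hgm.aestronglyMeasurable ?_
    refine (ae_restrict_iff' measurableSet_Ioi).2 (ae_of_all _ fun x hx => ?_)
    rw [Real.norm_of_nonneg (le_max_right _ _)]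
    exact le_mul_of_one_le_left (le_max_right _ _) (Real.one_le_rpow (le_of_lt hx) hα)

/-- The kernel `ε W` on the positive quadrant, extended by zero. -/
noncomputable def perturbation (ε : ℝ) (W : ℝ → ℝ → ℝ) (y z : ℝ) : ENNReal :=
  (Ioi (0 : ℝ) ×ˢ Ioi (0 : ℝ)).indicator (fun p => ENNReal.ofReal (ε * W p.1 p.2)) (y, z)

/-- The contribution of the kernel `ε W` to the profile equation in Laplace variables. -/
noncomputable def perturbationTerm (ε : ℝ) (W : ℝ → ℝ → ℝ) (f : ℝ → ℝ) (q : ℝ) : ENNReal :=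
  ∫⁻ y in Ioi 0, ∫⁻ z in Ioi 0, perturbation ε W y z *
    (ENNReal.ofReal (f y) * ENNReal.ofReal (1 - Real.exp (-(q * y)))) *
    (ENNReal.ofReal (f z) * ENNReal.ofReal (1 - Real.exp (-(q * z))))

lemma IsPerturbation.measurable_perturbation {α : ℝ} {W : ℝ → ℝ → ℝ} (hW : IsPerturbation α W)
    (ε : ℝ) : Measurable fun p : ℝ × ℝ => perturbation ε W p.1 p.2 := by
  classical
  have hs : MeasurableSet (Ioi (0 : ℝ) ×ˢ Ioi (0 : ℝ)) := measurableSet_Ioi.prod measurableSet_Ioi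
  have h := (ENNReal.continuous_ofReal.comp_continuousOn
    (hW.continuousOn.const_mul ε)).measurable_piecewise
    (continuousOn_const (c := (0 : ENNReal)) (s := (Ioi (0 : ℝ) ×ˢ Ioi (0 : ℝ))ᶜ)) hs
  convert h using 1
  ext p
  simp only [perturbation, indicator, piecewise]
  rfl

lemma IsPerturbation.perturbation_symm {α : ℝ} {W : ℝ → ℝ → ℝ} (hW : IsPerturbation α W)
    (ε y z : ℝ) : perturbation ε W y z = perturbation ε W z y := by
  by_cases hy : 0 < y <;> by_cases hz : 0 < z <;>
    simp [perturbation, indicator, hy, hz]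
  rw [hW.symm y hy z hz]

lemma IsNormalisedProfile.tendsto_desing_div_rpow {α ρ : ℝ} (hρ₀ : 0 < ρ) (hρ₁ : ρ < 1)
    {K : ℝ → ℝ → ℝ} {f : ℝ → ℝ} (hf : IsNormalisedProfile α ρ K f) (hA : Admissible f) :
    Tendsto (fun q => desing f q / q ^ ρ) (𝓝[>] 0) (𝓝 ρ) := by
  refine Smoluchowski.tendsto_desing_div_rpow hA hρ₀ hρ₁ ?_ ?_
  · exact fun R => (hf.locallyIntegrableOn_mul.integrableOn_compact_subset Icc_subset_Ici_self
      isCompact_Icc).mono_set Ioo_subset_Icc_self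
  · have hc : ρ ^ 2 / Real.Gamma (2 - ρ) ≠ 0 :=
      div_ne_zero (pow_ne_zero 2 hρ₀.ne') (Real.Gamma_pos_of_pos (by linarith)).ne'
    have hne : ∀ᶠ R : ℝ in atTop, ρ ^ 2 / Real.Gamma (2 - ρ) * R ^ (1 - ρ) ≠ 0 := by
      filter_upwards [eventually_gt_atTop 0] with R hR
      exact mul_ne_zero hc (Real.rpow_pos_of_pos hR _).ne'
    have h := ((Asymptotics.isEquivalent_iff_tendsto_one hne).1 hf.tail).const_mul
      (ρ ^ 2 / Real.Gamma (2 - ρ))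
    rw [mul_one] at h
    refine h.congr' ?_
    filter_upwards [hne, eventually_gt_atTop 0] with R hR hR0
    have := (Real.rpow_pos_of_pos hR0 (1 - ρ)).ne'
    simp only [Pi.div_apply]
    generalize (∫ y in Ioo 0 R, y * f y) = M
    rw [mul_div_assoc', mul_div_mul_left _ _ hc]

lemma profile_equation_ennreal {α ρ ε : ℝ} (hε : 0 ≤ ε) {W : ℝ → ℝ → ℝ}
    (hW : IsPerturbation α W) {f : ℝ → ℝ}
    (hf : IsNormalisedProfile α ρ (fun x y => 2 + ε * W x y) f) (hA : Admissible f) :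
    ∀ᵐ x ∂volume.restrict (Ioi (0 : ℝ)), ENNReal.ofReal (x ^ 2) * ENNReal.ofReal (f x) =
      ENNReal.ofReal (1 - ρ) * (∫⁻ y in Ioo 0 x, ENNReal.ofReal y * ENNReal.ofReal (f y)) +
      ∫⁻ y in Ioo 0 x, ∫⁻ z in Ioi (x - y), ENNReal.ofReal y * (2 + perturbation ε W y z) *
        ENNReal.ofReal (f y) * ENNReal.ofReal (f z) := by
  filter_upwards [hf.equation] with x hx
  rw [← ENNReal.ofReal_mul (sq_nonneg x), hx]
  congr 1
  · congr 1
    exact setLIntegral_congr_fun measurableSet_Ioo fun y hy => ENNReal.ofReal_mul hy.1.le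
  · refine setLIntegral_congr_fun measurableSet_Ioo fun y hy => ?_
    refine setLIntegral_congr_fun measurableSet_Ioi fun z hz => ?_
    have hy0 : 0 < y := hy.1
    have hz0 : 0 < z := (sub_pos.2 hy.2).trans hz
    have hw := mul_nonneg hε (hW.nonneg y hy0 z hz0)
    have hp : perturbation ε W y z = ENNReal.ofReal (ε * W y z) := by
      simp [perturbation, indicator, hy0, hz0]
    have h2 : (2 : ENNReal) = ENNReal.ofReal 2 := by simp
    have hk : 0 ≤ 2 + ε * W y z := by linarith
    rw [hp, h2, ← ENNReal.ofReal_add zero_le_two hw, ← ENNReal.ofReal_mul hy0.le,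
      ← ENNReal.ofReal_mul (mul_nonneg hy0.le hk),
      ← ENNReal.ofReal_mul (mul_nonneg (mul_nonneg hy0.le hk) (hA.nonneg y))]

lemma IsNormalisedProfile.riccati {α ρ ε : ℝ} (hρ₁ : ρ < 1) (hε : 0 ≤ ε) {W : ℝ → ℝ → ℝ}
    (hW : IsPerturbation α W) {f : ℝ → ℝ}
    (hf : IsNormalisedProfile α ρ (fun x y => 2 + ε * W x y) f) (hA : Admissible f)
    {q : ℝ} (hq : 0 < q) :
    perturbationTerm ε W f q ≠ ⊤ ∧ HasDerivAt (desing f) ((ρ * desing f q - desing f q ^ 2 -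
      (perturbationTerm ε W f q).toReal / 2) / q) q := by
  have hF : Measurable fun x => ENNReal.ofReal (f x) := hA.measurable.ennreal_ofReal
  have h := laplace_equation (ρ := ρ) hq hF (k := fun y z => 2 + perturbation ε W y z)
    ((hW.measurable_perturbation ε).const_add 2)
    (fun y z => by rw [hW.perturbation_symm]) (profile_equation_ennreal hε hW hf hA)
  rw [← ofReal_desing_sub hA hq, ← ofReal_desing hA hq.le] at h
  set a : ℝ → ENNReal := fun y =>
    ENNReal.ofReal (f y) * ENNReal.ofReal (1 - Real.exp (-(q * y))) with ha
  have ham : Measurable a := by fun_prop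
  have hsplit : ∫⁻ y in Ioi 0, ∫⁻ z in Ioi 0, (2 + perturbation ε W y z) * a y * a z =
      2 * (ENNReal.ofReal (desing f q) * ENNReal.ofReal (desing f q)) +
        perturbationTerm ε W f q := by
    have h1 : ∀ y, ∫⁻ z in Ioi 0, (2 + perturbation ε W y z) * a y * a z =
        2 * a y * (∫⁻ z in Ioi 0, a z) + ∫⁻ z in Ioi 0, perturbation ε W y z * a y * a z := by
      intro y
      rw [← lintegral_const_mul _ ham, ← lintegral_add_left (ham.const_mul _)]
      refine lintegral_congr fun z => ?_
      ring
    simp_rw [h1]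
    rw [lintegral_add_left ((ham.const_mul 2).mul_const _), lintegral_mul_const _
      (ham.const_mul 2), lintegral_const_mul _ ham, ofReal_desing hA hq.le, mul_assoc]
    rfl
  rw [hsplit] at h
  have hQ := desing_nonneg hA hq.le
  have hP : 0 ≤ desing f q - q * desingDeriv f q := by
    have : 0 ≤ ∫ x in Ioi 0, f x * (1 - Real.exp (-(q * x)) - q * x * Real.exp (-(q * x))) :=
      integral_nonneg fun x => mul_nonneg (hA.nonneg x) weight_numerator_nonneg
    convert this using 1
    rw [desing, desingDeriv, ← integral_const_mul,
      ← integral_sub (integrableOn_mul_one_sub_exp hA hq.le)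
        ((integrableOn_mul_mul_exp hA hq).const_mul q)]
    refine integral_congr_ae (ae_of_all _ fun x => ?_)
    simp only; ring
  -- Finiteness comes from the identity in `[0,∞]` itself, whose left-hand side is finite.
  have hE : perturbationTerm ε W f q ≠ ⊤ := by
    intro htop
    rw [htop, add_top, add_top] at h
    exact ENNReal.mul_ne_top ENNReal.ofNat_ne_top ENNReal.ofReal_ne_top h
  refine ⟨hE, (hasDerivAt_desing hA hq).congr_deriv ?_⟩
  have h' := congrArg ENNReal.toReal h
  rw [ENNReal.toReal_add (by finiteness) (by finiteness),
    ENNReal.toReal_add (by finiteness) (by finiteness)] at h'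
  simp only [ENNReal.toReal_mul, ENNReal.toReal_ofNat, ENNReal.toReal_ofReal hQ,
    ENNReal.toReal_ofReal hP, ENNReal.toReal_ofReal (by linarith : 0 ≤ 1 - ρ)] at h'
  rw [eq_div_iff hq.ne']
  linarith

/-- Positivity near `0` follows from the asymptotics and spreads by monotonicity. -/
lemma desing_pos {ρ : ℝ} (hρ₀ : 0 < ρ) {f : ℝ → ℝ} (hA : Admissible f)
    (hlim : Tendsto (fun q => desing f q / q ^ ρ) (𝓝[>] 0) (𝓝 ρ)) {q : ℝ} (hq : 0 < q) :
    0 < desing f q := by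
  obtain ⟨s, hs, hsq⟩ := ((hlim.eventually_const_lt hρ₀).and (Ioo_mem_nhdsGT hq)).exists
  have : 0 < desing f s := (div_pos_iff_of_pos_right (Real.rpow_pos_of_pos hsq.1 _)).1 hs
  exact this.trans_le (desing_mono hA hsq.1.le hsq.2.le)

/-- Fatou's lemma along `q = n + 1`, where `1 - e^{-qx}` tends to `1`. -/
lemma lintegral_le_of_desing_le {f : ℝ → ℝ} (hA : Admissible f) {m : ℝ}
    (h : ∀ q > 0, desing f q ≤ m) : ∫⁻ x in Ioi 0, ENNReal.ofReal (f x) ≤ ENNReal.ofReal m := by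
  have hm := hA.measurable
  have hlim : ∀ x > 0, Tendsto (fun n : ℕ => ENNReal.ofReal (f x) *
      ENNReal.ofReal (1 - Real.exp (-(((n : ℝ) + 1) * x)))) atTop (𝓝 (ENNReal.ofReal (f x))) := by
    intro x hx
    have h1 : Tendsto (fun n : ℕ => -(((n : ℝ) + 1) * x)) atTop atBot :=
      tendsto_neg_atTop_atBot.comp
        ((tendsto_atTop_add_const_right _ 1 tendsto_natCast_atTop_atTop).atTop_mul_const hx)
    have h2 := ((Real.tendsto_exp_atBot.comp h1).const_sub 1)
    have h3 := (ENNReal.continuous_ofReal.tendsto _).comp h2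
    have h4 := ENNReal.Tendsto.const_mul (a := ENNReal.ofReal (f x)) h3
      (Or.inr ENNReal.ofReal_ne_top)
    simpa using h4
  calc ∫⁻ x in Ioi 0, ENNReal.ofReal (f x)
      = ∫⁻ x in Ioi 0, liminf (fun n : ℕ => ENNReal.ofReal (f x) *
          ENNReal.ofReal (1 - Real.exp (-(((n : ℝ) + 1) * x)))) atTop :=
        setLIntegral_congr_fun measurableSet_Ioi fun x hx => (hlim x hx).liminf_eq.symm
    _ ≤ liminf (fun n : ℕ => ∫⁻ x in Ioi 0, ENNReal.ofReal (f x) *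
          ENNReal.ofReal (1 - Real.exp (-(((n : ℝ) + 1) * x)))) atTop :=
        lintegral_liminf_le fun n => by fun_prop
    _ ≤ liminf (fun _ : ℕ => ENNReal.ofReal m) atTop := by
        refine liminf_le_liminf (Eventually.of_forall fun n => ?_)
        have hn : (0 : ℝ) < n + 1 := by positivity
        rw [← ofReal_desing hA hn.le]
        exact ENNReal.ofReal_le_ofReal (h _ hn)
    _ = ENNReal.ofReal m := by simp

/-! ### Bounds on the perturbation term -/

/-- In each of the two terms bounding `W`, the variable in the numerator receives the exponent `β`
and the one in the denominator `β'`, so that both terms produce the same pair of moments, of orders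
`β + α` and `β' - α`. -/
lemma IsPerturbation.perturbation_mul_le {α ε β β' q y z : ℝ} (hε : 0 ≤ ε)
    {W : ℝ → ℝ → ℝ} (hW : IsPerturbation α W) (hβ₀ : 0 ≤ β) (hβ₁ : β ≤ 1) (hβ'₀ : 0 ≤ β')
    (hβ'₁ : β' ≤ 1) (hq : 0 < q) (hy : 0 < y) (hz : 0 < z) :
    perturbation ε W y z * ENNReal.ofReal (1 - Real.exp (-(q * y))) *
      ENNReal.ofReal (1 - Real.exp (-(q * z))) ≤
    ENNReal.ofReal (ε * q ^ (β + β')) *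
      (ENNReal.ofReal (y ^ (β + α)) * ENNReal.ofReal (z ^ (β' - α)) +
        ENNReal.ofReal (y ^ (β' - α)) * ENNReal.ofReal (z ^ (β + α))) := by
  have hp : perturbation ε W y z = ENNReal.ofReal (ε * W y z) := by
    simp [perturbation, indicator, hy, hz]
  have ey := one_sub_exp_nonneg hq.le hy.le
  have ez := one_sub_exp_nonneg hq.le hz.le
  have hw := hW.nonneg y hy z hz
  rw [hp, ← ENNReal.ofReal_mul (by positivity), ← ENNReal.ofReal_mul (by positivity),
    ← ENNReal.ofReal_mul (by positivity), ← ENNReal.ofReal_mul (by positivity),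
    ← ENNReal.ofReal_add (by positivity) (by positivity), ← ENNReal.ofReal_mul (by positivity)]
  refine ENNReal.ofReal_le_ofReal ?_
  calc ε * W y z * (1 - Real.exp (-(q * y))) * (1 - Real.exp (-(q * z)))
      ≤ ε * ((y / z) ^ α + (z / y) ^ α) * (1 - Real.exp (-(q * y))) *
        (1 - Real.exp (-(q * z))) := by gcongr; exact hW.le y hy z hz
    _ = ε * ((y / z) ^ α * ((1 - Real.exp (-(q * y))) * (1 - Real.exp (-(q * z)))) +
        (z / y) ^ α * ((1 - Real.exp (-(q * y))) * (1 - Real.exp (-(q * z))))) := by ring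
    _ ≤ ε * ((y / z) ^ α * ((q ^ β * y ^ β) * (q ^ β' * z ^ β')) +
        (z / y) ^ α * ((q ^ β' * y ^ β') * (q ^ β * z ^ β))) := by
        gcongr
        · exact one_sub_exp_le_rpow hβ₀ hβ₁ hq hy
        · exact one_sub_exp_le_rpow hβ'₀ hβ'₁ hq hz
        · exact one_sub_exp_le_rpow hβ'₀ hβ'₁ hq hy
        · exact one_sub_exp_le_rpow hβ₀ hβ₁ hq hz
    _ = _ := by
        rw [Real.div_rpow hy.le hz.le, Real.div_rpow hz.le hy.le, Real.rpow_add hq,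
          Real.rpow_add hy, Real.rpow_add hz, Real.rpow_sub hy, Real.rpow_sub hz]
        ring

lemma IsPerturbation.perturbationTerm_le {α ε β β' q : ℝ} (hε : 0 ≤ ε)
    {W : ℝ → ℝ → ℝ} (hW : IsPerturbation α W) (hβ₀ : 0 ≤ β) (hβ₁ : β ≤ 1) (hβ'₀ : 0 ≤ β')
    (hβ'₁ : β' ≤ 1) (hq : 0 < q) {f : ℝ → ℝ} (hf : Measurable f) :
    perturbationTerm ε W f q ≤ ENNReal.ofReal (ε * q ^ (β + β')) *
      (2 * ((∫⁻ x in Ioi 0, ENNReal.ofReal (x ^ (β + α)) * ENNReal.ofReal (f x)) *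
        ∫⁻ x in Ioi 0, ENNReal.ofReal (x ^ (β' - α)) * ENNReal.ofReal (f x))) := by
  set u : ℝ → ENNReal := fun x => ENNReal.ofReal (x ^ (β + α)) * ENNReal.ofReal (f x) with hu
  set v : ℝ → ENNReal := fun x => ENNReal.ofReal (x ^ (β' - α)) * ENNReal.ofReal (f x) with hv
  have hum : Measurable u := by fun_prop
  have hvm : Measurable v := by fun_prop
  calc perturbationTerm ε W f q
      ≤ ∫⁻ y in Ioi 0, ∫⁻ z in Ioi 0, ENNReal.ofReal (ε * q ^ (β + β')) *
          (u y * v z + v y * u z) := by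
        refine setLIntegral_mono' measurableSet_Ioi fun y hy => ?_
        refine setLIntegral_mono' measurableSet_Ioi fun z hz => ?_
        have h := mul_le_mul_left (hW.perturbation_mul_le hε hβ₀ hβ₁ hβ'₀ hβ'₁ hq hy hz)
          (ENNReal.ofReal (f y) * ENNReal.ofReal (f z))
        refine (le_of_eq ?_).trans (h.trans_eq ?_)
        · ring
        · simp only [hu, hv]; ring
    _ = _ := by
        have h1 : ∀ y, ∫⁻ z in Ioi 0, ENNReal.ofReal (ε * q ^ (β + β')) *
            (u y * v z + v y * u z) = ENNReal.ofReal (ε * q ^ (β + β')) *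
            (u y * (∫⁻ z in Ioi 0, v z) + v y * ∫⁻ z in Ioi 0, u z) := by
          intro y
          rw [lintegral_const_mul _ (by fun_prop), lintegral_add_left (by fun_prop),
            lintegral_const_mul _ hvm, lintegral_const_mul _ hum]
        simp_rw [h1]
        rw [lintegral_const_mul _ (by fun_prop), lintegral_add_left (by fun_prop),
          lintegral_mul_const _ hum, lintegral_mul_const _ hvm]
        ring

/-! ### Stability of the transforms -/

/-- Quantitative stability: an admissible normalised profile for `2 + ε W` has desingularised
Laplace transform within `O(ε q^(ρ+η))` of that of the constant-kernel profile. -/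
lemma exists_desing_bounds {α ρ : ℝ} (hα₀ : 0 ≤ α) (hαρ : α < ρ) (hρ : ρ < 1)
    {W : ℝ → ℝ → ℝ} (hW : IsPerturbation α W) :
    ∃ C ≥ 0, ∃ η > 0, ∀ ε ≥ 0, ∀ f : ℝ → ℝ,
      IsNormalisedProfile α ρ (fun x y => 2 + ε * W x y) f → Admissible f → ∀ q > 0,
        desing f q ≤ ρ * q ^ ρ / (1 + q ^ ρ) ∧
        ρ * q ^ ρ / (1 + q ^ ρ) - ε * C * q ^ (ρ + η) ≤ desing f q := by
  have hρ₀ : 0 < ρ := hα₀.trans_lt hαρ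
  -- With `ρ = α + 4η`, the choice `β = 3η`, `β' = α + 2η` gives `β + β' = ρ + η`, while the moment
  -- orders `β + α = ρ - η` and `β' - α = 2η` both lie in `(0, ρ)`.
  set η : ℝ := (ρ - α) / 4 with hη
  have hη₀ : 0 < η := by rw [hη]; linarith
  obtain ⟨C₁, hC₁, hmom₁⟩ := exists_moment_bound (ρ := ρ) (γ := 3 * η + α)
    (by linarith) (by linarith)
  obtain ⟨C₂, hC₂, hmom₂⟩ := exists_moment_bound (ρ := ρ) (γ := (α + 2 * η) - α)
    (by linarith) (by linarith)
  refine ⟨(C₁ * C₂).toReal / η, by positivity, η, hη₀, fun ε hε f hf hA => ?_⟩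
  have hlim := hf.tendsto_desing_div_rpow hρ₀ hρ hA
  have hpos : ∀ q > 0, 0 < desing f q := fun q hq => desing_pos hρ₀ hA hlim hq
  have hric := fun (q : ℝ) (hq : q > 0) => hf.riccati hρ hε hW hA hq
  -- Only `E ≥ 0` is used, so the moment bounds drawn from this estimate do not depend on `ε` or
  -- `f`.
  have hup : ∀ q > 0, desing f q ≤ ρ * q ^ ρ / (1 + q ^ ρ) := fun q hq =>
    le_of_riccati hρ₀ (fun q hq => (hric q hq).2) (fun q _ => by positivity) hpos hlim hq
  have hup₁ : ∀ q > 0, desing f q ≤ ρ := by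
    intro q hq
    have ht : 0 < q ^ ρ := Real.rpow_pos_of_pos hq _
    refine (hup q hq).trans ?_
    rw [div_le_iff₀ (by positivity)]
    nlinarith
  have hup₂ : ∀ q > 0, desing f q ≤ ρ * q ^ ρ := by
    intro q hq
    have ht : 0 < q ^ ρ := Real.rpow_pos_of_pos hq _
    exact (hup q hq).trans (div_le_self (by positivity) (by linarith))
  have hmass := lintegral_le_of_desing_le hA hup₁
  have hlap : ∀ q > 0, ∫⁻ x in Ioi 0, ENNReal.ofReal (f x) *
      ENNReal.ofReal (1 - Real.exp (-(q * x))) ≤ ENNReal.ofReal (ρ * q ^ ρ) := by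
    intro q hq
    rw [← ofReal_desing hA hq.le]
    exact ENNReal.ofReal_le_ofReal (hup₂ q hq)
  have hm₁ := hmom₁ _ hA.measurable.ennreal_ofReal hmass hlap
  have hm₂ := hmom₂ _ hA.measurable.ennreal_ofReal hmass hlap
  have hE : ∀ q > 0, (perturbationTerm ε W f q).toReal / 2 ≤
      ε * (C₁ * C₂).toReal * q ^ (ρ + η) := by
    intro q hq
    have h := (hW.perturbationTerm_le hε (β := 3 * η) (β' := α + 2 * η) (by linarith)
      (by linarith) (by linarith) (by linarith) hq hA.measurable).trans
      (mul_le_mul_right (mul_le_mul_right (mul_le_mul' hm₁ hm₂) 2) _)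
    rw [show 3 * η + (α + 2 * η) = ρ + η by rw [hη]; ring] at h
    have h' := ENNReal.toReal_mono (by finiteness) h
    have hq' : 0 ≤ ε * q ^ (ρ + η) := mul_nonneg hε (Real.rpow_nonneg hq.le _)
    rw [ENNReal.toReal_mul, ENNReal.toReal_mul (a := 2), ENNReal.toReal_ofReal hq',
      ENNReal.toReal_ofNat] at h'
    linarith
  intro q hq
  refine ⟨hup q hq, ?_⟩
  have := ge_of_riccati hρ₀ hη₀ (fun q hq => (hric q hq).2) hE hpos hlim hup hq
  rwa [← mul_div_assoc]

lemma exists_laplace_close {α ρ : ℝ} (hα₀ : 0 ≤ α) (hαρ : α < ρ) (hρ : ρ < 1)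
    {W : ℝ → ℝ → ℝ} (hW : IsPerturbation α W) {δ : ℝ} (hδ : 0 < δ) :
    ∃ ε₀ > 0, ∀ ε : ℝ, 0 ≤ ε → ε ≤ ε₀ → ∀ f : ℝ → ℝ,
      IsNormalisedProfile α ρ (fun x y => 2 + ε * W x y) f → IntegrableOn f (Ioi 0) ∧
        ∀ q > 0, |laplace f q - (ρ - ρ * q ^ ρ / (1 + q ^ ρ))| ≤ δ := by
  have hρ₀ : 0 < ρ := hα₀.trans_lt hαρ
  obtain ⟨C, hC, η, hη, hbd⟩ := exists_desing_bounds hα₀ hαρ hρ hW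
  -- `L^ρ = 2ρ/δ` makes `ρ - Q̄(L) = ρ/(1 + L^ρ)` at most `δ/2`; the other `δ/2` is left for the
  -- error of order `ε` on `(0, L]`. In `ε₀`, `C + 1` replaces `C` to avoid dividing by zero.
  set L : ℝ := (2 * ρ / δ) ^ ρ⁻¹ with hL
  have hL₀ : 0 < L := by positivity
  have hLρ : L ^ ρ = 2 * ρ / δ := Real.rpow_inv_rpow (by positivity) hρ₀.ne'
  have hLη : 0 < L ^ (ρ + η) := by positivity
  refine ⟨δ / 2 / ((C + 1) * L ^ (ρ + η)), by positivity, fun ε hε hεle f hf => ?_⟩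
  obtain ⟨g, hfg, hA, hg⟩ := hf.exists_admissible hα₀
  have hle : ∀ q > 0, ρ * q ^ ρ / (1 + q ^ ρ) ≤ ρ := by
    intro q hq
    have ht : 0 < q ^ ρ := Real.rpow_pos_of_pos hq _
    rw [div_le_iff₀ (by positivity)]
    nlinarith
  have herr : ∀ q > 0, q ≤ L → ε * C * q ^ (ρ + η) ≤ δ / 2 := by
    intro q hq hqL
    calc ε * C * q ^ (ρ + η) ≤ ε * (C + 1) * L ^ (ρ + η) := by gcongr; linarith
      _ = ε * ((C + 1) * L ^ (ρ + η)) := by ring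
      _ ≤ δ / 2 := (le_div_iff₀ (by positivity)).1 hεle
  have hLlow : ρ - δ ≤ desing g L := by
    have h1 := (hbd ε hε g hg hA L hL₀).2
    have h2 := herr L hL₀ le_rfl
    have h3 : ρ - δ / 2 ≤ ρ * L ^ ρ / (1 + L ^ ρ) := by
      have : 0 < L ^ ρ := by positivity
      rw [le_div_iff₀ (by positivity), hLρ]
      field_simp
      nlinarith
    linarith
  have hclose : ∀ q > 0, ρ * q ^ ρ / (1 + q ^ ρ) - δ ≤ desing g q := by
    intro q hq
    rcases le_total q L with h | h
    · linarith [(hbd ε hε g hg hA q hq).2, herr q hq h]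
    · linarith [desing_mono hA hL₀.le h, hle q hq]
  have hmass := lintegral_le_of_desing_le hA fun q hq => ((hbd ε hε g hg hA q hq).1).trans (hle q hq)
  have hgi : IntegrableOn g (Ioi 0) := by
    refine ⟨hA.measurable.aestronglyMeasurable, ?_⟩
    rw [hasFiniteIntegral_iff_ofReal (ae_of_all _ hA.nonneg)]
    exact hmass.trans_lt ENNReal.ofReal_lt_top
  have hmle : ∫ x in Ioi 0, g x ≤ ρ := by
    rw [← ofReal_integral_eq_lintegral_ofReal hgi (ae_of_all _ hA.nonneg)] at hmass
    exact (ENNReal.ofReal_le_ofReal_iff hρ₀.le).1 hmass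
  have hmge : desing g L ≤ ∫ x in Ioi 0, g x := by
    refine integral_mono (integrableOn_mul_one_sub_exp hA hL₀.le) hgi fun x => ?_
    exact mul_le_of_le_one_right (hA.nonneg x) (one_sub_exp_le_one L x)
  have hlap : ∀ q > 0, laplace f q = (∫ x in Ioi 0, g x) - desing g q := by
    intro q hq
    have h1 : laplace f q = laplace g q := by
      refine integral_congr_ae ?_
      filter_upwards [hfg] with x hx
      rw [hx]
    rw [h1, desing, ← integral_sub hgi (integrableOn_mul_one_sub_exp hA hq.le), laplace]
    refine integral_congr_ae (ae_of_all _ fun x => ?_)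
    simp only; ring
  refine ⟨hgi.congr_fun_ae hfg.symm, fun q hq => ?_⟩
  rw [hlap q hq, abs_le]
  -- The difference is `(m - ρ) + (Q̄ - Q)`, with `m` the mass. The first bracket lies in `[-δ, 0]`
  -- and the second in `[0, δ]`, so the errors do not accumulate.
  have h1 := hclose q hq
  have h2 := (hbd ε hε g hg hA q hq).1
  constructor <;> linarith

end Smoluchowski

theorem proposition5p8 (α ρ : ℝ) (hα₀ : 0 ≤ α) (hα₁ : α < 1) (hαρ : α < ρ) (hρ : ρ < 1)
    (W : ℝ → ℝ → ℝ) (hW : Smoluchowski.IsPerturbation α W)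
    (fbar : ℝ → ℝ) (hfbar : Smoluchowski.IsNormalisedProfile 0 ρ (fun _ _ => 2) fbar) :
    MeasureTheory.IntegrableOn fbar (Set.Ioi 0) MeasureTheory.volume ∧
    ∀ δ > 0, ∃ ε₀ > 0, ∀ ε : ℝ, 0 < ε → ε ≤ ε₀ →
      ∀ f : ℝ → ℝ, Smoluchowski.IsNormalisedProfile α ρ (fun x y => 2 + ε * W x y) f →
        MeasureTheory.IntegrableOn f (Set.Ioi 0) MeasureTheory.volume ∧
        ∀ q > 0, |Smoluchowski.laplace f q - Smoluchowski.laplace fbar q| ≤ δ := by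
  have hW₀ : Smoluchowski.IsPerturbation 0 (fun _ _ => 0) :=
    ⟨continuousOn_const, fun _ _ _ _ => rfl, fun _ _ _ _ _ _ => rfl, fun _ _ _ _ => le_rfl,
      fun _ _ _ _ => by simp⟩
  have hbar : Smoluchowski.IsNormalisedProfile 0 ρ (fun _ _ => 2 + 0 * 0) fbar := by
    simpa using hfbar
  -- The constant kernel is the case `α = 0`, `W = 0`, `ε = 0`, for which the closeness holds with
  -- every `δ`; no explicit formula for `fbar` is needed.
  have hconst : ∀ δ > 0, MeasureTheory.IntegrableOn fbar (Set.Ioi 0) MeasureTheory.volume ∧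
      ∀ q > 0, |Smoluchowski.laplace fbar q - (ρ - ρ * q ^ ρ / (1 + q ^ ρ))| ≤ δ := by
    intro δ hδ
    obtain ⟨ε₀, hε₀, h⟩ := Smoluchowski.exists_laplace_close le_rfl
      (hα₀.trans_lt hαρ) hρ hW₀ hδ
    exact h 0 le_rfl hε₀.le fbar hbar
  refine ⟨(hconst 1 one_pos).1, fun δ hδ => ?_⟩
  obtain ⟨ε₀, hε₀, h⟩ := Smoluchowski.exists_laplace_close hα₀ hαρ hρ hW (half_pos hδ)
  refine ⟨ε₀, hε₀, fun ε hε hεle f hf => ⟨(h ε hε.le hεle f hf).1, fun q hq => ?_⟩⟩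
  have h1 := (h ε hε.le hεle f hf).2 q hq
  have h2 := (hconst (δ / 2) (half_pos hδ)).2 q hq
  rw [abs_le] at h1 h2 ⊢
  constructor <;> linarith [h1.1, h1.2, h2.1, h2.2]
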